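/- **Setting.** Let $n\ge 1$ and let $\mathbf n=(n_1,\dots,n_N)$, $\mathbf k=(k_1,\dots,k_N)$ be tuples of non-negative integers with $1\le n_p\le n$. Put $N_a=\#\{p: n_p>a\}$, let $R=\mathbb C[x_a[i] : 1\le a\le n-1,\ 0\le i\le N_a-1]$, and let $x_a(z)=\sum_{i=0}^{N_a-1}x_a[i]\,z^{N_a-1-i}$. Let $J(\mathbf n,\mathbf k)\subset R$ be the ideal generated by the coefficients of $z^j$ in $\prod_{a=1}^{n-1}x_a(z)^{\nu_a}$ for all $\nu\in\mathbb Z_{\ge0}^{n-1}$ and all $j<\sum_{p=1}^N\bigl(\sum_{a=1}^{n_p-1}\nu_a-k_p\bigr)_+$, and let $W(\mathbf n,\mathbf k)=R/J(\mathbf n,\mathbf k)$. For $1\le b\le n$ let $\kappa^{(b)}$ be the conjugate of the partition formed by the $k_p$ with $n_p=b$, and put $\mu^{(a)}=\kappa^{(1)}+\dots+\kappa^{(a)}$. Write $W^{(n)}[\mu^{(n)},\dots,\mu^{(1)}]=W(\mathbf n,\mathbf k)$; up to isomorphisms matching the generators $x_b[i]$ (with $x_b[i]$ read as $0$ when $i\ge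 N_b$) this depends only on $n$ and on $\mu^{(n)},\dots,\mu^{(1)}$. If $\mu^{(n)}=\mu^{(n-1)}$, then $W^{(n)}[\mu^{(n)},\mu^{(n-1)},\dots,\mu^{(1)}]$ is identified with $W^{(n-1)}[\mu^{(n-1)},\dots,\mu^{(1)}]$. Below, $(\mu^{(n)},\dots,\mu^{(1)})$ runs over all sequences such that $\mu^{(1)}$ and all $\mu^{(a)}-\mu^{(a-1)}$ are partitions. **Theorem 2.12.** There is a unique family of sets $B^{(n)}[\mu^{(n)},\dots,\mu^{(1)}]$ of monomials in the symbols $x_b[i]$ such that 1. $B^{(1)}[\mu^{(1)}]=\{1\}$; 2. if $n\ge2$ and $\mu^{(n)}=\mu^{(n-1)}$, then $B^{(n)}[\mu^{(n)},\dots,\mu^{(1)}]=B^{(n-1)}[\mu^{(n-1)},\dots,\mu^{(1)}]$; 3. if $n\ge2$ and the length $k$ of $\mu^{(n)}-\mu^{(n-1)}$ is positive, then, with $a=n-1$, $$B^{(n)}[\mu^{(n)},\dots,\mu^{(1)}]=\iota\bigl(B^{(n)}[\mu^{(n)},\mu^{(n-1)}+(1^k),\mu^{(n-2)},\dots,\mu^{(1)}]\bigr)\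 \sqcup\ x_a[0]\,B^{(n)}[\mu^{(n)}-\mathbf e_k,\mu^{(n-1)},\dots,\mu^{(1)}],$$ where $\iota$ is the substitution $x_b[i]\mapsto x_b[i+\delta_{ab}]$, $(1^k)$ is the partition with $k$ parts equal to $1$, $\mathbf e_k$ is the $k$-th unit vector, and $x_a[0]\,B$ denotes elementwise multiplication by $x_a[0]$. For every $(\mathbf n,\mathbf k)$ with associated sequence $(\mu^{(n)},\dots,\mu^{(1)})$, the monomials in $B^{(n)}[\mu^{(n)},\dots,\mu^{(1)}]$ involve only the variables of $R$, and their classes are pairwise distinct and form a basis of $W^{(n)}[\mu^{(n)},\dots,\mu^{(1)}]=W(\mathbf n,\mathbf k)$. Moreover, in case 3 the substitution $\iota$ induces an algebra homomorphism $W^{(n)}[\mu^{(n)},\mu^{(n-1)}+(1^k),\dots,\mu^{(1)}]\to W^{(n)}[\mu^{(n)},\mu^{(n-1)},\dots,\mu^{(1)}]$, and the displayed decomposition also holds, as a disjoint union, for the corresponding bases as subsets of $W^{(n)}[\mu^{(n)},\mu^{(n-1)},\dots,\mu^{(1)}]$. -/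

import Mathlib

noncomputable section

namespace FusionBasis

/-! ### The modules `W(n, k) = R / J(n, k)` -/

/-- Two `N`-tuples of non-negative integers `(n_1, …, n_N)` and `(k_1, …, k_N)` with
`1 ≤ n_p ≤ n`, where `n ≥ 1`. -/
structure Datum (n : ℕ) where
  pos : 1 ≤ n
  N : ℕ
  nn : Fin N → ℕ
  kk : Fin N → ℕ
  one_le : ∀ p, 1 ≤ nn p
  le : ∀ p, nn p ≤ n

namespace Datum

variable {n : ℕ} (D : Datum n)

/-- `N_a = #{p : n_p > a}`. -/
def Ncard (a : ℕ) : ℕ := (Finset.univ.filter fun p => a < D.nn p).card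

/-- The index set of the variables: `(a, i)` stands for `x_a[i]`, with
`1 ≤ a ≤ n - 1` and `0 ≤ i ≤ N_a - 1`. -/
def vars : Set (ℕ × ℕ) := {v | 1 ≤ v.1 ∧ v.1 < n ∧ v.2 < D.Ncard v.1}

/-- The polynomial ring `R` over `ℂ` in the indeterminates `x_a[i]`. -/
abbrev R : Type := MvPolynomial D.vars ℂ

open Classical in
/-- The indeterminate `x_a[i]` of `R`, read as `0` if `(a, i)` is outside the index set. -/
def x (a i : ℕ) : D.R :=
  if h : (a, i) ∈ D.vars then MvPolynomial.X ⟨(a, i), h⟩ else 0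

/-- The current `x_a(z) = ∑_{i = 0}^{N_a - 1} x_a[i] z^{N_a - 1 - i}`. -/
def current (a : ℕ) : Polynomial D.R :=
  ∑ i ∈ Finset.range (D.Ncard a),
    Polynomial.C (D.x a i) * Polynomial.X ^ (D.Ncard a - 1 - i)

/-- `∑_p (ν_1 + ⋯ + ν_{n_p - 1} - k_p)_+`; the subtraction of natural numbers is truncated
at `0`, which is the positive part. -/
def ordBound (ν : ℕ → ℕ) : ℕ := ∑ p, ((∑ a ∈ Finset.Ico 1 (D.nn p), ν a) - D.kk p)

/-- The ideal `J(n, k)` generated by the coefficients of `z^j` in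
`x_1(z)^{ν_1} ⋯ x_{n-1}(z)^{ν_{n-1}}` for `j < ordBound ν` and all `ν`
(only `ν_1, …, ν_{n-1}` matter). -/
def J : Ideal D.R :=
  Ideal.span {c | ∃ (ν : ℕ → ℕ) (j : ℕ), j < D.ordBound ν ∧
    c = (∏ a ∈ Finset.Ico 1 n, D.current a ^ ν a).coeff j}

/-- The module (in fact `ℂ`-algebra) `W(n, k) = R / J(n, k)`. -/
abbrev W : Type := D.R ⧸ D.J

/-- The class of `x_a[i]` in `W(n, k)`. -/
def gen (a i : ℕ) : D.W := Ideal.Quotient.mk D.J (D.x a i)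

end Datum

/-- Monomials in the symbols `x_a[i]`, given by their exponents. -/
abbrev Mon : Type := (ℕ × ℕ) →₀ ℕ

/-- The class in `W(n, k)` of the monomial `∏ x_a[i]^{m(a, i)}`. -/
def Datum.mon {n : ℕ} (D : Datum n) (m : Mon) : D.W :=
  m.prod fun v e => D.gen v.1 v.2 ^ e

/-! ### Chains of partitions -/

/-- A partition, as a weakly decreasing sequence of natural numbers ending in zeros;
`f j` is the part with (1-based) number `j + 1`. -/
def IsPartition (f : ℕ → ℕ) : Prop := Antitone f ∧ ∃ L, ∀ j, L ≤ j → f j = 0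

/-- The length of a partition, i.e. the number of its non-zero parts. -/
def length (f : ℕ → ℕ) : ℕ := sInf {j | f j = 0}

theorem lt_length_iff {f : ℕ → ℕ} (hf : IsPartition f) (j : ℕ) :
    j < length f ↔ 0 < f j := by
  obtain ⟨ha, L, hL⟩ := hf
  have hmem : f (length f) = 0 := Nat.sInf_mem (s := {j | f j = 0}) ⟨L, hL L le_rfl⟩
  constructor
  · intro h
    have : j ∉ {j | f j = 0} := Nat.notMem_of_lt_sInf h
    exact Nat.pos_of_ne_zero this
  · intro h
    by_contra hc
    have := ha (not_lt.mp hc)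
    omega

/-- Sequences `(μ^{(n)}, …, μ^{(1)})`, `n ≥ 1`, such that `μ^{(1)}` and all differences
`μ^{(a)} - μ^{(a-1)}` are partitions: these are the sequences of partial sums
`μ^{(a)} = κ^{(1)} + ⋯ + κ^{(a)}` of `n` partitions. Here `part a` is `μ^{(a)}` for `1 ≤ a ≤ n`.
Outside this range the value is fixed by convention: it is `0` for `a = 0` and `μ^{(n)}`
for `a > n`. -/
@[ext]
structure PartitionChain (n : ℕ) where
  pos : 1 ≤ n
  part : ℕ → ℕ → ℕ
  part_zero : ∀ j, part 0 j = 0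
  le_succ : ∀ a j, part a j ≤ part (a + 1) j
  isPartition_diff : ∀ a, IsPartition fun j => part (a + 1) j - part a j
  part_of_le : ∀ a, n ≤ a → part a = part n

/-- The chain attached to `(n, k)`: `μ^{(a)} = κ^{(1)} + ⋯ + κ^{(a)}`, where `κ^{(b)}` is the
conjugate of the partition formed by the `k_p` with `n_p = b`. So the `j`-th part (1-based)
of `μ^{(a)}` is the number of `p` with `n_p ≤ a` and `k_p ≥ j`. -/
def Datum.chain {n : ℕ} (D : Datum n) : PartitionChain n where
  pos := D.pos
  part a j := (Finset.univ.filter fun p => D.nn p ≤ a ∧ j < D.kk p).card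
  part_zero j := by
    rw [Finset.card_eq_zero, Finset.filter_eq_empty_iff]
    intro p _ h
    have := D.one_le p
    omega
  le_succ a j := by
    apply Finset.card_le_card
    intro p
    simp only [Finset.mem_filter, Finset.mem_univ, true_and]
    omega
  isPartition_diff a := by
    have key : ∀ j, (Finset.univ.filter fun p => D.nn p ≤ a + 1 ∧ j < D.kk p).card -
        (Finset.univ.filter fun p => D.nn p ≤ a ∧ j < D.kk p).card =
        (Finset.univ.filter fun p => D.nn p = a + 1 ∧ j < D.kk p).card := by
      intro j
      rw [← Finset.card_sdiff_of_subset]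
      · congr 1
        ext p
        simp only [Finset.mem_sdiff, Finset.mem_filter, Finset.mem_univ, true_and]
        omega
      · intro p
        simp only [Finset.mem_filter, Finset.mem_univ, true_and]
        omega
    simp only [key]
    refine ⟨?_, ∑ p, D.kk p, ?_⟩
    · intro i j hij
      apply Finset.card_le_card
      intro p
      simp only [Finset.mem_filter, Finset.mem_univ, true_and]
      omega
    · intro j hj
      rw [Finset.card_eq_zero, Finset.filter_eq_empty_iff]
      intro p _ h
      have := Finset.single_le_sum (f := D.kk) (fun _ _ => Nat.zero_le _) (Finset.mem_univ p)
      omega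
  part_of_le a ha := by
    funext j
    congr 1
    ext p
    have := D.le p
    simp only [Finset.mem_filter, Finset.mem_univ, true_and]
    omega

namespace PartitionChain

variable {n : ℕ}

/-- If `μ^{(n+1)} = μ^{(n)}`, the chain `(μ^{(n)}, …, μ^{(1)})`. -/
def trunc (μ : PartitionChain (n + 1)) (hn : 1 ≤ n) (h : μ.part (n + 1) = μ.part n) :
    PartitionChain n where
  pos := hn
  part := μ.part
  part_zero := μ.part_zero
  le_succ := μ.le_succ
  isPartition_diff := μ.isPartition_diff
  part_of_le a ha := by
    rcases Nat.eq_or_lt_of_le ha with rfl | h'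
    · rfl
    · rw [μ.part_of_le a h', h]

/-- The length `k` of `μ^{(n+1)} - μ^{(n)}`. -/
def topLength (μ : PartitionChain (n + 1)) : ℕ :=
  length fun j => μ.part (n + 1) j - μ.part n j

theorem lt_topLength_iff (μ : PartitionChain (n + 1)) (j : ℕ) :
    j < μ.topLength ↔ 0 < μ.part (n + 1) j - μ.part n j :=
  lt_length_iff (μ.isPartition_diff n) j

/-- The chain `(μ^{(n+1)}, μ^{(n)} + (1^k), μ^{(n-1)}, …, μ^{(1)})`, where `k` is the length of
`μ^{(n+1)} - μ^{(n)}`. -/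
def addColumn (μ : PartitionChain (n + 1)) (hn : 1 ≤ n) : PartitionChain (n + 1) where
  pos := μ.pos
  part a j := if a = n ∧ j < μ.topLength then μ.part a j + 1 else μ.part a j
  part_zero j := by
    rw [if_neg (by omega)]
    exact μ.part_zero j
  le_succ a j := by
    have h1 := μ.le_succ a j
    by_cases h : a = n
    · subst h
      have h2 := μ.lt_topLength_iff j
      split_ifs <;> omega
    · split_ifs <;> omega
  isPartition_diff a := by
    obtain ⟨hanti, L, hL⟩ := μ.isPartition_diff a
    refine ⟨?_, max L μ.topLength, ?_⟩
    · intro i j hij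
      have h1 : μ.part (a + 1) j - μ.part a j ≤ μ.part (a + 1) i - μ.part a i := hanti hij
      have h2 := μ.le_succ a i
      have h3 := μ.le_succ a j
      by_cases h : a = n
      · subst h
        have h4 := μ.lt_topLength_iff i
        have h5 := μ.lt_topLength_iff j
        dsimp only
        split_ifs <;> omega
      · dsimp only
        split_ifs <;> omega
    · intro j hj
      have h1 : μ.part (a + 1) j - μ.part a j = 0 := hL j (le_trans (le_max_left _ _) hj)
      have h2 : μ.topLength ≤ j := le_trans (le_max_right _ _) hj
      dsimp only
      split_ifs <;> omega
  part_of_le a ha := by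
    funext j
    rw [if_neg (by omega), if_neg (by omega), μ.part_of_le a ha]

/-- The chain `(μ^{(n+1)} - e_k, μ^{(n)}, …, μ^{(1)})`, where `k` is the length of
`μ^{(n+1)} - μ^{(n)}` (meant for `k > 0`). -/
def removeBox (μ : PartitionChain (n + 1)) : PartitionChain (n + 1) where
  pos := μ.pos
  part a j := if n + 1 ≤ a ∧ j + 1 = μ.topLength then μ.part a j - 1 else μ.part a j
  part_zero j := by
    rw [if_neg (by omega)]
    exact μ.part_zero j
  le_succ a j := by
    have h1 := μ.le_succ a j
    by_cases h : a = n
    · subst h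
      have h2 := μ.lt_topLength_iff j
      split_ifs <;> omega
    · split_ifs <;> omega
  isPartition_diff a := by
    obtain ⟨hanti, L, hL⟩ := μ.isPartition_diff a
    refine ⟨?_, L, ?_⟩
    · intro i j hij
      have h1 : μ.part (a + 1) j - μ.part a j ≤ μ.part (a + 1) i - μ.part a i := hanti hij
      have h2 := μ.le_succ a i
      have h3 := μ.le_succ a j
      rcases lt_trichotomy a n with h | h | h
      · dsimp only
        split_ifs <;> omega
      · subst h
        have h4 := μ.lt_topLength_iff i
        have h5 := μ.lt_topLength_iff j
        rcases Nat.eq_or_lt_of_le hij with rfl | hlt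
        · exact le_rfl
        · dsimp only
          split_ifs <;> omega
      · have e1 := congrFun (μ.part_of_le a h) i
        have e2 := congrFun (μ.part_of_le (a + 1) (by omega)) i
        have e3 := congrFun (μ.part_of_le a h) j
        have e4 := congrFun (μ.part_of_le (a + 1) (by omega)) j
        dsimp only
        split_ifs <;> omega
    · intro j hj
      have h1 : μ.part (a + 1) j - μ.part a j = 0 := hL j hj
      by_cases h : a = n
      · subst h
        have h2 := μ.lt_topLength_iff j
        dsimp only
        split_ifs <;> omega
      · dsimp only
        split_ifs <;> omega
  part_of_le a ha := by
    funext j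
    have e := congrFun (μ.part_of_le a ha) j
    by_cases h : j + 1 = μ.topLength
    · rw [if_pos ⟨ha, h⟩, if_pos ⟨le_rfl, h⟩, e]
    · rw [if_neg (by tauto), if_neg (by tauto), e]

end PartitionChain

/-- Every chain of partitions is the chain of some `(n, k)`. -/
theorem exists_datum {n : ℕ} (μ : PartitionChain n) : ∃ D : Datum n, D.chain = μ := by
  let κ : ℕ → ℕ → ℕ := fun b j => μ.part (b + 1) j - μ.part b j
  have hκ : ∀ b i, IsPartition fun j => κ b j - i := by
    intro b i
    obtain ⟨ha, L, hL⟩ := μ.isPartition_diff b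
    refine ⟨fun j j' hj => Nat.sub_le_sub_right (ha hj) i, L, fun j hj => ?_⟩
    have : κ b j = 0 := hL j hj
    simp [this]
  let P := Σ b : Fin n, Fin (κ b 0)
  let e : Fin (Fintype.card P) ≃ P := (Fintype.equivFin P).symm
  let k : P → ℕ := fun q => length fun j => κ q.1 j - q.2
  refine ⟨⟨μ.pos, Fintype.card P, fun p => (e p).1 + 1, fun p => k (e p),
    fun p => Nat.le_add_left _ _, fun p => (e p).1.2⟩, ?_⟩
  apply PartitionChain.ext
  funext a j
  have hk : ∀ q : P, j < k q ↔ (q.2 : ℕ) < κ q.1 j := by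
    intro q
    have h := lt_length_iff (hκ q.1 q.2) j
    exact h.trans Nat.sub_pos_iff_lt
  have hsum : ∀ a, a ≤ n → ∑ b ∈ Finset.range a, κ b j = μ.part a j := by
    intro a _
    have hm : Monotone fun a => μ.part a j := monotone_nat_of_le_succ fun a => μ.le_succ a j
    have h := Finset.sum_range_tsub hm a
    simpa [κ, μ.part_zero] using h
  have h1 : (Finset.univ.filter fun p => ((e p).1 : ℕ) + 1 ≤ a ∧ j < k (e p)).card =
      (Finset.univ.filter fun q : P => (q.1 : ℕ) < a ∧ (q.2 : ℕ) < κ q.1 j).card := by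
    refine Finset.card_equiv e fun p => ?_
    simp only [Finset.mem_filter, Finset.mem_univ, true_and, hk, Nat.succ_le_iff]
  have h2 : (Finset.univ.filter fun q : P => (q.1 : ℕ) < a ∧ (q.2 : ℕ) < κ q.1 j).card =
      ∑ b : Fin n, if (b : ℕ) < a then κ b j else 0 := by
    rw [Finset.card_filter, Fintype.sum_sigma]
    refine Finset.sum_congr rfl fun b _ => ?_
    by_cases hb : (b : ℕ) < a
    · have hle : κ b j ≤ κ b 0 := (μ.isPartition_diff b).1 (Nat.zero_le j)
      simp only [hb, true_and, if_true]
      rw [← Finset.card_filter, Fin.card_filter_val_lt, min_eq_right hle]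
    · simp [hb]
  have h3 : (∑ b : Fin n, if (b : ℕ) < a then κ b j else 0) = μ.part a j := by
    rw [Fin.sum_univ_eq_sum_range (fun b => if b < a then κ b j else 0) n,
      ← Finset.sum_filter]
    rcases le_total a n with h | h
    · rw [← hsum a h]
      congr 1
      ext b
      simp only [Finset.mem_filter, Finset.mem_range]
      omega
    · rw [μ.part_of_le a h, ← hsum n le_rfl]
      congr 1
      ext b
      simp only [Finset.mem_filter, Finset.mem_range]
      omega
  exact h1.trans (h2.trans h3)

/-! ### The recursion -/

/-- The substitution `x_b[i] ↦ x_b[i + δ_{ab}]` on monomials. -/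
def shift (a : ℕ) (m : Mon) : Mon :=
  m.mapDomain fun v => (v.1, v.2 + if v.1 = a then 1 else 0)

/-- Multiplication of monomials by `x_a[0]`. -/
def mulX0 (a : ℕ) (m : Mon) : Mon := Finsupp.single (a, 0) 1 + m

/-- A family of sets of monomials `B^{(n)}[μ^{(n)}, …, μ^{(1)}]` satisfying the recursion. -/
structure IsRecursiveFamily (B : (n : ℕ) → PartitionChain n → Set Mon) : Prop where
  /-- `B^{(1)}[μ^{(1)}] = {1}`. -/
  base : ∀ μ : PartitionChain 1, B 1 μ = {0}
  /-- `B^{(n+1)}[μ^{(n)}, μ^{(n)}, …, μ^{(1)}] = B^{(n)}[μ^{(n)}, …, μ^{(1)}]`. -/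
  trunc : ∀ (n : ℕ) (hn : 1 ≤ n) (μ : PartitionChain (n + 1))
    (h : μ.part (n + 1) = μ.part n), B (n + 1) μ = B n (μ.trunc hn h)
  /-- If the length `k` of `μ^{(n+1)} - μ^{(n)}` is positive, the set for `μ` is the union of the
  shifted set for `(μ^{(n+1)}, μ^{(n)} + (1^k), …)` and `x_n[0]` times the set for
  `(μ^{(n+1)} - e_k, μ^{(n)}, …)`. -/
  step : ∀ (n : ℕ) (hn : 1 ≤ n) (μ : PartitionChain (n + 1)), 0 < μ.topLength →
    B (n + 1) μ = shift n '' B (n + 1) (μ.addColumn hn) ∪ mulX0 n '' B (n + 1) μ.removeBox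

end FusionBasis

end

noncomputable section

namespace FusionBasis

/-! Reversing the order of coefficients presents `W(n, k)` as a quotient of the ring of all symbols
`x_a[i]`. With `x_a(t) = ∑ x_a[i] t^i`, the relations say that the coefficient of `t^s` in `∏
x_a(t)^{ν_a}` vanishes when `s + |ν| > ∑_p min(ν_1 + ⋯ + ν_{n_p - 1}, k_p)`. That sum depends only
on the chain, so all the algebra can be done upstairs, modulo `relIdeal` (`symbolHom_mem_J_iff`).

Spanning (`exists_monSpan_add_relIdeal`). For a chain of level `n + 1`, let `∂` be the derivative in
`x_n[0]`. Its kernel on polynomials is the image of the shift `ι`. Every relation of the chain with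
a box removed is `∂` of a relation of `μ` (`relIdeal_removeBox_le_map_pderiv`), and `ι` sends
relations of the chain with a column added to relations of `μ`
(`relIdeal_addColumn_le_comap_shiftHom`). Given `f`, expand `∂f` by induction, integrate, and
subtract: the rest lies in the image of `ι` and is expanded by induction again.

Independence (`linearIndependent_mon`). Attach to the distinct points `p = 0, …, N - 1` the rings
`ℂ[y_{1,p}, …, y_{n_p - 1,p}]` truncated above degree `k_p`. The map `x_a[i] ↦ ∑_p p^i y_{a,p}` to
their tensor product is onto and kills deformations of the relations by terms of lower weight
(`exists_deformation`). Hence monomials spanning modulo the relations also span the tensor product,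
and there are at least as many of them as elements of `box`, its monomial basis. Splitting `box`
along one variable `y_{n,q}`, with `k_q` maximal among the `p` with `n_p = n + 1`, reproduces the
recursion for `B`, so `|B| ≤ |box|`. No proper subset of `B` can therefore span. -/

/-! ### Induction along the recursion -/

namespace PartitionChain

variable {n : ℕ}

/-- The partition `κ^{(b+1)} = μ^{(b+1)} - μ^{(b)}`. -/
def diff (μ : PartitionChain n) (b j : ℕ) : ℕ := μ.part (b + 1) j - μ.part b j

theorem diff_trunc (μ : PartitionChain (n + 1)) (hn : 1 ≤ n)
    (h : μ.part (n + 1) = μ.part n) (b j : ℕ) : (μ.trunc hn h).diff b j = μ.diff b j := rfl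

theorem lt_topLength_iff_diff (μ : PartitionChain (n + 1)) (j : ℕ) :
    j < μ.topLength ↔ 0 < μ.diff n j :=
  μ.lt_topLength_iff j

theorem diff_removeBox (μ : PartitionChain (n + 1)) (b j : ℕ) (hb : b ≤ n) :
    μ.removeBox.diff b j = μ.diff b j - if b = n ∧ j + 1 = μ.topLength then 1 else 0 := by
  have h1 := μ.le_succ b j
  have h2 := μ.lt_topLength_iff j
  simp only [diff, removeBox]
  split_ifs <;> omega

theorem diff_removeBox_top (μ : PartitionChain (n + 1)) (j : ℕ) :
    μ.removeBox.diff n j = μ.diff n j - if j + 1 = μ.topLength then 1 else 0 := by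
  simpa using μ.diff_removeBox n j le_rfl

theorem diff_addColumn_top (μ : PartitionChain (n + 1)) (hn : 1 ≤ n) (j : ℕ) :
    (μ.addColumn hn).diff n j = μ.diff n j - if j < μ.topLength then 1 else 0 := by
  have h1 := μ.le_succ n j
  simp only [diff, addColumn, true_and]
  rw [if_neg (by omega)]
  split_ifs <;> omega

theorem diff_addColumn_pred (μ : PartitionChain (n + 1)) (hn : 1 ≤ n) (b j : ℕ)
    (hb : b + 1 = n) :
    (μ.addColumn hn).diff b j = μ.diff b j + if j < μ.topLength then 1 else 0 := by
  have h1 := μ.le_succ b j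
  simp only [diff, addColumn]
  split_ifs <;> omega

theorem diff_addColumn_of_lt (μ : PartitionChain (n + 1)) (hn : 1 ≤ n) (b j : ℕ)
    (hb : b + 1 < n) : (μ.addColumn hn).diff b j = μ.diff b j := by
  simp only [diff, addColumn]
  split_ifs <;> omega

theorem part_eq_of_topLength_eq_zero (μ : PartitionChain (n + 1)) (h : μ.topLength = 0) :
    μ.part (n + 1) = μ.part n := by
  funext j
  have h1 := μ.le_succ n j
  have h2 := μ.lt_topLength_iff j
  omega

theorem topLength_eq_zero_of_part_eq (μ : PartitionChain (n + 1))
    (h : μ.part (n + 1) = μ.part n) : μ.topLength = 0 := by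
  have h2 := μ.lt_topLength_iff 0
  rw [h] at h2
  omega

/-- Induction on chains of partitions along the recursion for the monomial bases. -/
theorem recursionInduction {P : ∀ n, PartitionChain n → Prop}
    (base : ∀ μ : PartitionChain 1, P 1 μ)
    (trunc : ∀ (n : ℕ) (hn : 1 ≤ n) (μ : PartitionChain (n + 1))
      (h : μ.part (n + 1) = μ.part n), P n (μ.trunc hn h) → P (n + 1) μ)
    (step : ∀ (n : ℕ) (hn : 1 ≤ n) (μ : PartitionChain (n + 1)), 0 < μ.topLength →
      P (n + 1) (μ.addColumn hn) → P (n + 1) μ.removeBox → P (n + 1) μ) :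
    ∀ (n : ℕ) (μ : PartitionChain n), P n μ := by
  intro n
  induction n with
  | zero => intro μ; exact absurd μ.pos (by omega)
  | succ n ih =>
    intro μ
    rcases Nat.eq_zero_or_pos n with rfl | hn
    · exact base μ
    obtain ⟨-, L, hL⟩ := μ.isPartition_diff n
    -- The inner induction is on a bound `s` for the size of `κ^{(n+1)}`. The same `L` serves
    -- throughout, because both moves only shrink that partition.
    obtain ⟨s, hs⟩ : ∃ s, ∑ j ∈ Finset.range L, μ.diff n j ≤ s := ⟨_, le_rfl⟩
    replace hL : ∀ j, L ≤ j → μ.diff n j = 0 := hL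
    induction s generalizing μ with
    | zero =>
      have h0 : μ.topLength = 0 := by
        by_contra h
        have h1 := (μ.lt_topLength_iff_diff 0).1 (by omega)
        have h2 : 0 ∈ Finset.range L := by
          rw [Finset.mem_range]
          by_contra hc
          have := hL 0 (by omega)
          omega
        have := Finset.single_le_sum (f := μ.diff n) (fun _ _ => Nat.zero_le _) h2
        omega
      exact trunc n hn μ (μ.part_eq_of_topLength_eq_zero h0) (ih _)
    | succ s ihs =>
      rcases Nat.eq_zero_or_pos μ.topLength with h0 | hpos
      · exact trunc n hn μ (μ.part_eq_of_topLength_eq_zero h0) (ih _)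
      have key : ∀ μ' : PartitionChain (n + 1), (∀ j, μ'.diff n j ≤ μ.diff n j) →
          (∃ j, μ'.diff n j < μ.diff n j) → P (n + 1) μ' := by
        rintro μ' hle ⟨j, hj⟩
        refine ihs μ' ?_ fun i hi => Nat.le_zero.1 ((hle i).trans (hL i hi).le)
        have : ∑ j ∈ Finset.range L, μ'.diff n j < ∑ j ∈ Finset.range L, μ.diff n j := by
          refine Finset.sum_lt_sum (fun i _ => hle i) ⟨j, ?_, hj⟩
          rw [Finset.mem_range]
          by_contra hc
          have := hL j (by omega)
          have := hle j
          omega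
        omega
      -- Adding the column to `μ^{(n)}` lowers every non-zero part of `κ^{(n+1)}`, in particular the
      -- first. Removing a box lowers the last one, whose zero-based index is `topLength - 1`.
      refine step n hn μ hpos (key _ (fun j => ?_) ⟨0, ?_⟩)
        (key _ (fun j => ?_) ⟨μ.topLength - 1, ?_⟩)
      · rw [diff_addColumn_top]; omega
      · have := (μ.lt_topLength_iff_diff 0).1 hpos
        rw [diff_addColumn_top, if_pos hpos]; omega
      · rw [diff_removeBox_top]; omega
      · have := (μ.lt_topLength_iff_diff (μ.topLength - 1)).1 (by omega)
        rw [diff_removeBox_top, if_pos (by omega)]; omega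

end PartitionChain

/-! ### The family of monomials -/

/-- Membership of a monomial in the set `B^{(n)}[μ^{(n)}, …, μ^{(1)}]`. -/
inductive IsBasisMonomial : (n : ℕ) → PartitionChain n → Mon → Prop
  | base (μ : PartitionChain 1) : IsBasisMonomial 1 μ 0
  | trunc (n : ℕ) (hn : 1 ≤ n) (μ : PartitionChain (n + 1)) (h : μ.part (n + 1) = μ.part n)
      (m : Mon) : IsBasisMonomial n (μ.trunc hn h) m → IsBasisMonomial (n + 1) μ m
  | shift (n : ℕ) (hn : 1 ≤ n) (μ : PartitionChain (n + 1)) (h : 0 < μ.topLength) (m : Mon) :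
      IsBasisMonomial (n + 1) (μ.addColumn hn) m → IsBasisMonomial (n + 1) μ (shift n m)
  | mulX0 (n : ℕ) (hn : 1 ≤ n) (μ : PartitionChain (n + 1)) (h : 0 < μ.topLength) (m : Mon) :
      IsBasisMonomial (n + 1) μ.removeBox m → IsBasisMonomial (n + 1) μ (mulX0 n m)

/-- The set `B^{(n)}[μ^{(n)}, …, μ^{(1)}]` of monomials. -/
def basisMonomials (n : ℕ) (μ : PartitionChain n) : Set Mon := {m | IsBasisMonomial n μ m}

theorem isRecursiveFamily_basisMonomials : IsRecursiveFamily basisMonomials where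
  base μ := by
    ext m
    constructor
    · intro h
      cases h with
      | base => rfl
      | trunc n hn => omega
      | shift n hn => omega
      | mulX0 n hn => omega
    · rintro rfl
      exact .base μ
  trunc n hn μ h := by
    ext m
    have h0 := μ.topLength_eq_zero_of_part_eq h
    constructor
    · intro hm
      cases hm with
      | base => omega
      | trunc n hn _ h m hm => exact hm
      | shift n hn => omega
      | mulX0 n hn => omega
    · exact fun hm => .trunc n hn μ h m hm
  step n hn μ h := by
    ext m
    constructor
    · intro hm
      cases hm with
      | base => omega
      | trunc n hn _ h' => exact absurd (μ.topLength_eq_zero_of_part_eq h') (by omega)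
      | shift n hn _ h m hm => exact Or.inl ⟨m, hm, rfl⟩
      | mulX0 n hn _ h m hm => exact Or.inr ⟨m, hm, rfl⟩
    · rintro (⟨m, hm, rfl⟩ | ⟨m, hm, rfl⟩)
      · exact .shift n hn μ h m hm
      · exact .mulX0 n hn μ h m hm

theorem IsRecursiveFamily.eq {B B' : (n : ℕ) → PartitionChain n → Set Mon}
    (hB : IsRecursiveFamily B) (hB' : IsRecursiveFamily B') : B = B' := by
  funext n μ
  induction n, μ using PartitionChain.recursionInduction with
  | base μ => rw [hB.base, hB'.base]
  | trunc n hn μ h ih => rw [hB.trunc n hn μ h, hB'.trunc n hn μ h, ih]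
  | step n hn μ h ih₁ ih₂ => rw [hB.step n hn μ h, hB'.step n hn μ h, ih₁, ih₂]

/-- The symbol `x_n[0]` cannot occur in a shifted monomial. -/
theorem disjoint_shift_mulX0 (n : ℕ) (S T : Set Mon) :
    Disjoint (shift n '' S) (mulX0 n '' T) := by
  rw [Set.disjoint_left]
  rintro _ ⟨m, -, rfl⟩ ⟨m', -, h⟩
  have h1 : shift n m (n, 0) = 0 := by
    refine Finsupp.mapDomain_of_notMem_range _ _ ?_
    rintro ⟨v, hv⟩
    have h1 := congrArg Prod.fst hv
    have h2 := congrArg Prod.snd hv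
    simp only at h1 h2
    rw [if_pos h1] at h2
    omega
  rw [← h] at h1
  simp [mulX0] at h1

theorem finite_basisMonomials (n : ℕ) (μ : PartitionChain n) : (basisMonomials n μ).Finite := by
  induction n, μ using PartitionChain.recursionInduction with
  | base μ =>
    rw [isRecursiveFamily_basisMonomials.base]
    exact Set.finite_singleton _
  | trunc n hn μ h ih => rwa [isRecursiveFamily_basisMonomials.trunc n hn μ h]
  | step n hn μ h ih₁ ih₂ =>
    rw [isRecursiveFamily_basisMonomials.step n hn μ h]
    exact (ih₁.image _).union (ih₂.image _)

/-! ### The universal presentation -/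

/-- The polynomial ring in all the symbols `x_a[i]`. -/
abbrev SymbolRing : Type := MvPolynomial (ℕ × ℕ) ℂ

/-- The generating series `∑ x_a[i] t^i`. -/
def series (a : ℕ) : PowerSeries SymbolRing := PowerSeries.mk fun i => MvPolynomial.X (a, i)

/-- The product `∏ x_a(t)^{ν_a}`. -/
def seriesMon (ν : ℕ →₀ ℕ) : PowerSeries SymbolRing := ν.prod fun a e => series a ^ e

theorem seriesMon_add (ν ν' : ℕ →₀ ℕ) : seriesMon (ν + ν') = seriesMon ν * seriesMon ν' :=
  Finsupp.prod_add_index' (by simp) (fun _ _ _ => pow_add _ _ _)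

theorem seriesMon_single (a e : ℕ) : seriesMon (Finsupp.single a e) = series a ^ e :=
  Finsupp.prod_single_index (by simp)

/-- The sum `ν_1 + ⋯ + ν_{b-1}`. -/
def partialSum (ν : ℕ →₀ ℕ) (b : ℕ) : ℕ := ∑ a ∈ Finset.Ico 1 b, ν a

theorem partialSum_add_single (ν : ℕ →₀ ℕ) (a e b : ℕ) :
    partialSum (ν + Finsupp.single a e) b = partialSum ν b + if 1 ≤ a ∧ a < b then e else 0 := by
  simp [partialSum, Finset.sum_add_distrib, Finsupp.single_apply]

namespace PartitionChain

variable {n : ℕ}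

/-- In terms of `(n, k)`, the number `∑_p min(ν_1 + ⋯ + ν_{n_p - 1}, k_p)`. -/
def relBound (μ : PartitionChain n) (ν : ℕ →₀ ℕ) : ℕ :=
  ∑ b ∈ Finset.range n, ∑ j ∈ Finset.range (partialSum ν (b + 1)), μ.diff b j

/-- The ideal of relations of `W[μ^{(n)}, …, μ^{(1)}]` between the symbols `x_a[i]`. -/
def relIdeal (μ : PartitionChain n) : Ideal SymbolRing :=
  Ideal.span {c | ∃ (ν : ℕ →₀ ℕ) (s : ℕ), μ.relBound ν < s + ν.degree ∧
    c = (seriesMon ν).coeff s}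

theorem coeff_mem_relIdeal (μ : PartitionChain n) {ν : ℕ →₀ ℕ} {s : ℕ}
    (h : μ.relBound ν < s + ν.degree) : (seriesMon ν).coeff s ∈ μ.relIdeal :=
  Ideal.subset_span ⟨ν, s, h, rfl⟩

theorem relBound_mono (μ : PartitionChain n) {ν ν' : ℕ →₀ ℕ} (h : ν ≤ ν') :
    μ.relBound ν ≤ μ.relBound ν' := by
  refine Finset.sum_le_sum fun b _ => Finset.sum_le_sum_of_subset ?_
  exact Finset.range_subset_range.2 (Finset.sum_le_sum fun a _ => h a)

/-- Only first parts enter, and the sum telescopes. For the chain of `(n, k)` it counts the `p` with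
`n_p > a` and `k_p > 0`, hence is at most `N_a`. -/
theorem relBound_single (μ : PartitionChain n) (a : ℕ) (ha : 1 ≤ a) :
    μ.relBound (Finsupp.single a 1) = μ.part n 0 - μ.part a 0 := by
  have hs : ∀ b, partialSum (Finsupp.single a 1) (b + 1) = if a < b + 1 then 1 else 0 := by
    intro b
    have := partialSum_add_single 0 a 1 (b + 1)
    rw [zero_add] at this
    rw [this]
    simp [partialSum, ha]
  have key : ∀ m, ∑ b ∈ Finset.range m,
      ∑ j ∈ Finset.range (partialSum (Finsupp.single a 1) (b + 1)), μ.diff b j = μ.part m 0 - μ.part a 0 := by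
    have hm : Monotone fun a => μ.part a 0 := monotone_nat_of_le_succ fun a => μ.le_succ a 0
    intro m
    induction m with
    | zero => simp [μ.part_zero]
    | succ m ih =>
      rw [Finset.sum_range_succ, ih, hs]
      split_ifs with h
      · have h1 : μ.part a 0 ≤ μ.part m 0 := hm (by omega)
        have h2 := μ.le_succ m 0
        simp only [Finset.sum_range_one, diff]
        omega
      · have h1 : μ.part (m + 1) 0 ≤ μ.part a 0 := hm (by omega)
        have h2 := μ.le_succ m 0
        simp only [Finset.range_zero, Finset.sum_empty]
        omega
  exact key n

theorem relBound_single_zero (μ : PartitionChain n) (e : ℕ) :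
    μ.relBound (Finsupp.single 0 e) = 0 := by
  have hs : ∀ b, partialSum (Finsupp.single 0 e) b = 0 := by
    intro b
    have := partialSum_add_single 0 0 e b
    rw [zero_add] at this
    rw [this]
    simp [partialSum]
  simp [relBound, hs]

/-- These are the relations with `ν = e_a`. They eliminate the symbols outside the index set of `R`.
-/
theorem X_mem_relIdeal (μ : PartitionChain n) {a i : ℕ}
    (h : μ.relBound (Finsupp.single a 1) ≤ i) : MvPolynomial.X (a, i) ∈ μ.relIdeal := by
  have := μ.coeff_mem_relIdeal (ν := Finsupp.single a 1) (s := i) (by simpa using by omega)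
  simpa [seriesMon_single, series] using this

theorem relIdeal_trunc (μ : PartitionChain (n + 1)) (hn : 1 ≤ n)
    (h : μ.part (n + 1) = μ.part n) : (μ.trunc hn h).relIdeal = μ.relIdeal := by
  have : (μ.trunc hn h).relBound = μ.relBound := by
    funext ν
    simp only [relBound, Finset.sum_range_succ _ n, diff_trunc]
    have h0 : ∀ j, μ.diff n j = 0 := fun j => by rw [diff, h, Nat.sub_self]
    simp [h0]
  rw [relIdeal, relIdeal, this]

theorem relBound_add_single (μ : PartitionChain (n + 1)) (hn : 1 ≤ n) (ν : ℕ →₀ ℕ) :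
    μ.relBound (ν + Finsupp.single n 1) = μ.relBound ν + μ.diff n (partialSum ν (n + 1)) := by
  simp only [relBound, Finset.sum_range_succ _ n, partialSum_add_single, hn, true_and]
  rw [if_pos (by omega), Finset.sum_range_succ, ← add_assoc]
  congr 2
  refine Finset.sum_congr rfl fun b hb => ?_
  have := Finset.mem_range.1 hb
  rw [if_neg (by omega), add_zero]

/-- The removed box lies in the part of zero-based index `topLength - 1`, which enters the sum
exactly when `ν_1 + ⋯ + ν_n` reaches `topLength`. -/
theorem relBound_removeBox (μ : PartitionChain (n + 1)) (hpos : 0 < μ.topLength) (ν : ℕ →₀ ℕ) :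
    μ.relBound ν =
      μ.removeBox.relBound ν + if μ.topLength ≤ partialSum ν (n + 1) then 1 else 0 := by
  simp only [relBound, Finset.sum_range_succ _ n, diff_removeBox_top]
  have h1 : ∀ b ∈ Finset.range n, ∀ j, μ.removeBox.diff b j = μ.diff b j := by
    intro b hb j
    have := Finset.mem_range.1 hb
    rw [diff_removeBox _ _ _ (by omega), if_neg (by omega), Nat.sub_zero]
  have h2 : ∀ q, ∑ j ∈ Finset.range q, μ.diff n j =
      (∑ j ∈ Finset.range q, (μ.diff n j - if j + 1 = μ.topLength then 1 else 0)) +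
        if μ.topLength ≤ q then 1 else 0 := by
    intro q
    induction q with
    | zero => simp; omega
    | succ q ih =>
      rw [Finset.sum_range_succ, Finset.sum_range_succ, ih]
      have := μ.lt_topLength_iff_diff q
      split_ifs <;> omega
  rw [h2, ← add_assoc]
  congr 2
  exact Finset.sum_congr rfl fun b hb => Finset.sum_congr rfl fun j _ => (h1 b hb j).symm

/-- The column moves from `κ^{(n+1)}` to `κ^{(n)}`. When `ν_n = 0`, both are summed over the same
range. -/
theorem relBound_addColumn_of_eq_zero (μ : PartitionChain (n + 1)) (hn : 1 ≤ n) (ν : ℕ →₀ ℕ)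
    (hν : ν n = 0) : (μ.addColumn hn).relBound ν = μ.relBound ν := by
  obtain ⟨m, rfl⟩ : ∃ m, n = m + 1 := ⟨n - 1, by omega⟩
  simp only [relBound, Finset.sum_range_succ _ (m + 1), Finset.sum_range_succ _ m]
  have h1 : partialSum ν (m + 1 + 1) = partialSum ν (m + 1) := by
    rw [partialSum, Finset.sum_Ico_succ_top (by omega), hν, add_zero, partialSum]
  have h2 : ∀ b ∈ Finset.range m, ∀ j, (μ.addColumn hn).diff b j = μ.diff b j := by
    intro b hb j
    have := Finset.mem_range.1 hb
    exact μ.diff_addColumn_of_lt hn b j (by omega)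
  simp only [h1]
  rw [add_assoc _ _ (∑ _ ∈ _, _), add_assoc _ _ (∑ _ ∈ _, _)]
  congr 1
  · exact Finset.sum_congr rfl fun b hb => Finset.sum_congr rfl fun j _ => h2 b hb j
  · rw [← Finset.sum_add_distrib, ← Finset.sum_add_distrib]
    refine Finset.sum_congr rfl fun j _ => ?_
    rw [diff_addColumn_top, diff_addColumn_pred _ _ _ _ rfl]
    have := μ.lt_topLength_iff_diff j
    split_ifs <;> omega

/-- Each further factor `x_n(t)` adds one part of `κ^{(n+1)}` to the bound, and the move lowers that
part by at most one. -/
theorem relBound_le_relBound_addColumn (μ : PartitionChain (n + 1)) (hn : 1 ≤ n) (ν : ℕ →₀ ℕ)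
    (hν : ν n = 0) {i m : ℕ} (him : i ≤ m) :
    μ.relBound (ν + Finsupp.single n i) ≤
      (μ.addColumn hn).relBound (ν + Finsupp.single n m) + i := by
  suffices h : μ.relBound (ν + Finsupp.single n i) ≤
      (μ.addColumn hn).relBound (ν + Finsupp.single n i) + i by
    refine h.trans (Nat.add_le_add_right (relBound_mono _ ?_) _)
    gcongr
  clear him
  induction i with
  | zero => simp [relBound_addColumn_of_eq_zero μ hn ν hν]
  | succ i ih =>
    rw [Finsupp.single_add, ← add_assoc, relBound_add_single _ hn, relBound_add_single _ hn,
      diff_addColumn_top]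
    split_ifs <;> omega

end PartitionChain

/-- The target is only a subspace, such as the image of a derivation, so the generators have to be
tested together with all their monomial multiples. -/
theorem ideal_span_le_of_mul_mem {S : Set SymbolRing} (N : Submodule ℂ SymbolRing)
    (h : ∀ g ∈ S, ∀ (u : Mon) (c : ℂ), MvPolynomial.monomial u c * g ∈ N) :
    (Ideal.span S).restrictScalars ℂ ≤ N := by
  have h' : ∀ g ∈ S, ∀ r : SymbolRing, r * g ∈ N := by
    intro g hg r
    induction r using MvPolynomial.induction_on' with
    | monomial u c => exact h g hg u c
    | add p q hp hq => rw [add_mul]; exact N.add_mem hp hq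
  intro f hf
  have : ∀ r : SymbolRing, r * f ∈ N := by
    refine Submodule.span_induction (p := fun f _ => ∀ r : SymbolRing, r * f ∈ N) h'
      (by simp) ?_ ?_ hf
    · intro x y _ _ hx hy r
      rw [mul_add]
      exact N.add_mem (hx r) (hy r)
    · intro a x _ hx r
      rw [smul_eq_mul, ← mul_assoc]
      exact hx _
  simpa using this 1

/-! ### The derivative with respect to `x_a[0]` -/

/-- The coefficientwise extension of `∂/∂x_a[0]` to power series. -/
def seriesDeriv (a : ℕ) :
    Derivation ℂ (PowerSeries SymbolRing) (PowerSeries SymbolRing) :=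
  Derivation.mk'
    { toFun := fun f => PowerSeries.mk fun s => MvPolynomial.pderiv (a, 0) (f.coeff s)
      map_add' := fun f g => by ext1; simp
      map_smul' := fun c f => by
        ext1 s
        have : PowerSeries.coeff s (c • f) = c • PowerSeries.coeff s f := rfl
        rw [PowerSeries.coeff_mk, this, Derivation.map_smul]
        exact congrArg (c • ·) (PowerSeries.coeff_mk s
          fun s => MvPolynomial.pderiv (a, 0) (f.coeff s)).symm }
    fun f g => by
      ext1 s
      simp [PowerSeries.coeff_mul, map_sum, Derivation.leibniz, Finset.sum_add_distrib]
      rw [Finset.Nat.sum_antidiagonal_swap.symm]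
      simp

theorem coeff_seriesDeriv (a s : ℕ) (f : PowerSeries SymbolRing) :
    (seriesDeriv a f).coeff s = MvPolynomial.pderiv (a, 0) (f.coeff s) :=
  PowerSeries.coeff_mk s fun s => MvPolynomial.pderiv (a, 0) (f.coeff s)

/-- Since `x_a[0]` is the constant term of `x_a(t)`, the derivation acts on products of the series
as differentiation in `x_a(t)`. -/
theorem seriesDeriv_series (a b : ℕ) : seriesDeriv a (series b) = if a = b then 1 else 0 := by
  ext1 s
  rw [coeff_seriesDeriv, series, PowerSeries.coeff_mk, MvPolynomial.pderiv_X]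
  split_ifs with h
  · subst h
    simp [PowerSeries.coeff_one, Pi.single_apply]
  · simp [Ne.symm h]

theorem seriesDeriv_seriesMon_of_eq_zero (a : ℕ) (ν : ℕ →₀ ℕ) (hν : ν a = 0) :
    seriesDeriv a (seriesMon ν) = 0 := by
  refine Finset.prod_induction (s := ν.support) _ (fun f => seriesDeriv a f = 0) ?_ (by simp) ?_
  · intro f g hf hg
    rw [Derivation.leibniz, hf, hg]
    simp
  · intro b hb
    have : a ≠ b := by
      rintro rfl
      exact Finsupp.mem_support_iff.1 hb hν
    rw [Derivation.leibniz_pow, seriesDeriv_series, if_neg this]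
    simp

theorem seriesDeriv_seriesMon_add_single (a e : ℕ) (ν : ℕ →₀ ℕ) (hν : ν a = 0) :
    seriesDeriv a (seriesMon (ν + Finsupp.single a (e + 1))) =
      (e + 1 : ℂ) • seriesMon (ν + Finsupp.single a e) := by
  rw [seriesMon_add, seriesMon_add, seriesMon_single, seriesMon_single, Derivation.leibniz,
    seriesDeriv_seriesMon_of_eq_zero a ν hν, Derivation.leibniz_pow, seriesDeriv_series,
    if_pos rfl]
  simp [← Nat.cast_smul_eq_nsmul ℂ]

theorem pderiv_coeff_seriesMon_add_single (a s : ℕ) (ν : ℕ →₀ ℕ) :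
    MvPolynomial.pderiv (a, 0) ((seriesMon (ν + Finsupp.single a 1)).coeff s) =
      (ν a + 1 : ℂ) • (seriesMon ν).coeff s := by
  have h := seriesDeriv_seriesMon_add_single a (ν a) (ν.erase a) (by simp)
  have h1 : ν.erase a + Finsupp.single a (ν a) = ν := Finsupp.erase_add_single a ν
  rw [Finsupp.single_add, ← add_assoc, h1] at h
  rw [← coeff_seriesDeriv, h]
  rfl

theorem pderiv_coeff_seriesMon_of_eq_zero (a s : ℕ) (ν : ℕ →₀ ℕ) (hν : ν a = 0) :
    MvPolynomial.pderiv (a, 0) ((seriesMon ν).coeff s) = 0 := by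
  rw [← coeff_seriesDeriv, seriesDeriv_seriesMon_of_eq_zero a ν hν, map_zero]

/-! ### Lifting relations through the derivative -/

namespace PartitionChain

variable {n : ℕ}

/-- Past the end of `κ^{(n+1)}` a further factor `x_n(t)` does not raise the bound, so `ν + e_n`
gives a relation of `μ`. Differentiating `u` times it gives a non-zero multiple of the wanted
element plus a term in which `u` has lost one `x_n[0]`. Induct on that exponent. -/
theorem monomial_mul_coeff_mem_of_topLength_le (μ : PartitionChain (n + 1)) (hn : 1 ≤ n)
    (N : Submodule ℂ SymbolRing) (hN : ∀ f ∈ μ.relIdeal, MvPolynomial.pderiv (n, 0) f ∈ N)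
    (e : ℕ) (u : Mon) (hu : u (n, 0) = e) (c : ℂ) (ν : ℕ →₀ ℕ) (s : ℕ)
    (hk : μ.topLength ≤ partialSum ν (n + 1)) (hs : μ.relBound ν < s + ν.degree + 1) :
    MvPolynomial.monomial u c * (seriesMon ν).coeff s ∈ N := by
  induction e using Nat.strong_induction_on generalizing u c ν with
  | _ e ih =>
    have hb : μ.relBound (ν + Finsupp.single n 1) < s + (ν + Finsupp.single n 1).degree := by
      have := μ.lt_topLength_iff_diff (partialSum ν (n + 1))
      rw [relBound_add_single μ hn, map_add, Finsupp.degree_single]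
      omega
    have h1 := hN _ (μ.relIdeal.mul_mem_left (MvPolynomial.monomial u c)
      (μ.coeff_mem_relIdeal hb))
    rw [MvPolynomial.pderiv_mul, pderiv_coeff_seriesMon_add_single, MvPolynomial.pderiv_monomial,
      mul_smul_comm] at h1
    have h2 : MvPolynomial.monomial (u - Finsupp.single (n, 0) 1) (c * (u (n, 0) : ℂ)) *
        (seriesMon (ν + Finsupp.single n 1)).coeff s ∈ N := by
      rcases Nat.eq_zero_or_pos e with rfl | he
      · rw [hu, Nat.cast_zero, mul_zero, MvPolynomial.monomial_zero, zero_mul]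
        exact N.zero_mem
      · refine ih (e - 1) (by omega) _ (by simp [hu]) _ _ ?_ (by omega)
        rw [partialSum_add_single]
        omega
    have h3 := (N.add_mem_iff_right h2).1 h1
    exact (N.smul_mem_iff (by exact_mod_cast Nat.succ_ne_zero (ν n))).1 h3

/-- Differentiating `x_n[0] u` times the relation gives a non-zero multiple of the wanted element
plus a term with the relation for `ν - e_n`. That one is still within the bound, because the part of
`κ^{(n+1)}` lost is positive. Induct on `ν_n`. -/
theorem monomial_mul_coeff_mem_of_lt_topLength (μ : PartitionChain (n + 1)) (hn : 1 ≤ n)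
    (N : Submodule ℂ SymbolRing) (hN : ∀ f ∈ μ.relIdeal, MvPolynomial.pderiv (n, 0) f ∈ N)
    (e : ℕ) (u : Mon) (c : ℂ) (ν : ℕ →₀ ℕ) (hν : ν n = e) (s : ℕ)
    (hk : partialSum ν (n + 1) ≤ μ.topLength) (hs : μ.relBound ν < s + ν.degree) :
    MvPolynomial.monomial u c * (seriesMon ν).coeff s ∈ N := by
  induction e using Nat.strong_induction_on generalizing u c ν with
  | _ e ih =>
    have hu : (u + Finsupp.single (n, 0) 1 : Mon) (n, 0) = u (n, 0) + 1 := by simp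
    have h1 := hN _ (μ.relIdeal.mul_mem_left
      (MvPolynomial.monomial (u + Finsupp.single (n, 0) 1) c) (μ.coeff_mem_relIdeal hs))
    have h0 : MvPolynomial.monomial u (c * ((u (n, 0) + 1 : ℕ) : ℂ)) =
        ((u (n, 0) + 1 : ℕ) : ℂ) • MvPolynomial.monomial u c := by
      rw [MvPolynomial.smul_monomial, smul_eq_mul, mul_comm]
    rw [MvPolynomial.pderiv_mul, MvPolynomial.pderiv_monomial, add_tsub_cancel_right, hu,
      h0, smul_mul_assoc] at h1
    have h2 : MvPolynomial.monomial (u + Finsupp.single (n, 0) 1) c *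
        MvPolynomial.pderiv (n, 0) ((seriesMon ν).coeff s) ∈ N := by
      rcases Nat.eq_zero_or_pos e with rfl | he
      · rw [pderiv_coeff_seriesMon_of_eq_zero _ _ _ hν, mul_zero]
        exact N.zero_mem
      · obtain ⟨ν, rfl⟩ : ∃ ν', ν = ν' + Finsupp.single n 1 :=
          ⟨ν - Finsupp.single n 1, (tsub_add_cancel_of_le (by simp; omega)).symm⟩
        rw [pderiv_coeff_seriesMon_add_single, mul_smul_comm]
        rw [partialSum_add_single, if_pos (by omega)] at hk
        rw [relBound_add_single μ hn, map_add, Finsupp.degree_single] at hs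
        have := μ.lt_topLength_iff_diff (partialSum ν (n + 1))
        rw [Finsupp.add_apply, Finsupp.single_eq_same] at hν
        exact N.smul_mem _ (ih (ν n) (by omega) _ _ _ rfl (by omega) (by omega))
    have h3 := (N.add_mem_iff_left h2).1 h1
    exact (N.smul_mem_iff (Nat.cast_ne_zero.2 (Nat.succ_ne_zero _))).1 h3

theorem relIdeal_removeBox_le_map_pderiv (μ : PartitionChain (n + 1)) (hn : 1 ≤ n)
    (hpos : 0 < μ.topLength) :
    μ.removeBox.relIdeal.restrictScalars ℂ ≤
      (μ.relIdeal.restrictScalars ℂ).map (MvPolynomial.pderiv (n, 0)).toLinearMap := by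
  have hN : ∀ f ∈ μ.relIdeal, MvPolynomial.pderiv (n, 0) f ∈
      (μ.relIdeal.restrictScalars ℂ).map (MvPolynomial.pderiv (n, 0)).toLinearMap :=
    fun f hf => Submodule.mem_map.2 ⟨f, hf, rfl⟩
  refine ideal_span_le_of_mul_mem _ ?_
  rintro _ ⟨ν, s, hs, rfl⟩ u c
  have := μ.relBound_removeBox hpos ν
  by_cases hk : μ.topLength ≤ partialSum ν (n + 1)
  · rw [if_pos hk] at this
    exact μ.monomial_mul_coeff_mem_of_topLength_le hn _ hN _ u rfl c ν s hk (by omega)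
  · rw [if_neg hk] at this
    exact μ.monomial_mul_coeff_mem_of_lt_topLength hn _ hN _ u c ν rfl s (by omega) (by omega)

end PartitionChain

/-! ### The substitution `x_b[i] ↦ x_b[i + δ_{ab}]` -/

/-- The index map `(b, i) ↦ (b, i + δ_{ab})`. -/
def shiftIndex (a : ℕ) (v : ℕ × ℕ) : ℕ × ℕ := (v.1, v.2 + if v.1 = a then 1 else 0)

theorem shiftIndex_injective (a : ℕ) : Function.Injective (shiftIndex a) := by
  rintro ⟨b, i⟩ ⟨c, j⟩ h
  simp only [shiftIndex, Prod.mk.injEq] at h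
  obtain ⟨rfl, h⟩ := h
  simpa using h

theorem mem_range_shiftIndex {a : ℕ} {v : ℕ × ℕ} (hv : v ≠ (a, 0)) :
    v ∈ Set.range (shiftIndex a) := by
  obtain ⟨b, i⟩ := v
  by_cases hb : b = a
  · subst hb
    have hi : i ≠ 0 := by
      rintro rfl
      exact hv rfl
    exact ⟨(b, i - 1), by simp [shiftIndex]; omega⟩
  · exact ⟨(b, i), by simp [shiftIndex, hb]⟩

/-- The substitution `x_b[i] ↦ x_b[i + δ_{ab}]`. -/
def shiftHom (a : ℕ) : SymbolRing →ₐ[ℂ] SymbolRing := MvPolynomial.rename (shiftIndex a)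

theorem shiftHom_X (a b i : ℕ) :
    shiftHom a (MvPolynomial.X (b, i)) = MvPolynomial.X (b, i + if b = a then 1 else 0) :=
  MvPolynomial.rename_X _ _

theorem shiftHom_monomial (a : ℕ) (m : Mon) (c : ℂ) :
    shiftHom a (MvPolynomial.monomial m c) = MvPolynomial.monomial (shift a m) c :=
  MvPolynomial.rename_monomial _ _ _

/-- In characteristic zero a vanishing derivative means that `x_a[0]` does not occur, and every
other symbol is a shifted one. -/
theorem exists_shiftHom_eq_of_pderiv_eq_zero {a : ℕ} {f : SymbolRing}
    (hf : MvPolynomial.pderiv (a, 0) f = 0) : ∃ g, shiftHom a g = f := by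
  refine MvPolynomial.exists_rename_eq_of_vars_subset_range f (shiftIndex a)
    (shiftIndex_injective a) fun v hv => mem_range_shiftIndex ?_
  rintro rfl
  obtain ⟨u, hu, hau⟩ := (MvPolynomial.mem_vars_iff_mem_support _).1 hv
  have h := MvPolynomial.coeff_pderiv (i := (a, 0)) f (u - Finsupp.single (a, 0) 1)
  rw [hf, MvPolynomial.coeff_zero, tsub_add_cancel_of_le] at h
  · rcases mul_eq_zero.1 h.symm with h | h
    · exact MvPolynomial.mem_support_iff.1 hu h
    · exact absurd h (Nat.cast_add_one_ne_zero _)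
  · rw [Finsupp.single_le_iff]
    exact Nat.one_le_iff_ne_zero.2 (Finsupp.mem_support_iff.1 hau)

theorem map_shiftHom_series_of_ne {a b : ℕ} (h : b ≠ a) :
    PowerSeries.map (shiftHom a : SymbolRing →+* SymbolRing) (series b) = series b := by
  ext1 s
  simp [series, shiftHom_X, h]

theorem X_mul_map_shiftHom_series (a : ℕ) :
    PowerSeries.X * PowerSeries.map (shiftHom a : SymbolRing →+* SymbolRing) (series a) =
      series a - PowerSeries.C (MvPolynomial.X (a, 0)) := by
  ext1 s
  cases s with
  | zero => simp [series]
  | succ s => simp [series, shiftHom_X, PowerSeries.coeff_succ_X_mul]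

/-- From `t ι(x_a(t)) = x_a(t) - x_a[0]`: each of the `m` shifted factors moves the index by one. -/
theorem coeff_map_shiftHom_seriesMon (a m s : ℕ) (ν : ℕ →₀ ℕ) (hν : ν a = 0) :
    shiftHom a ((seriesMon (ν + Finsupp.single a m)).coeff s) =
      (seriesMon ν * (series a - PowerSeries.C (MvPolynomial.X (a, 0))) ^ m).coeff (s + m) := by
  have h : PowerSeries.map (shiftHom a : SymbolRing →+* SymbolRing) (seriesMon ν) =
      seriesMon ν := by
    rw [seriesMon, Finsupp.prod, map_prod]
    refine Finset.prod_congr rfl fun b hb => ?_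
    rw [map_pow, map_shiftHom_series_of_ne]
    rintro rfl
    exact Finsupp.mem_support_iff.1 hb hν
  rw [← X_mul_map_shiftHom_series, mul_pow, mul_left_comm, PowerSeries.coeff_X_pow_mul,
    ← h, ← map_pow, ← map_mul, PowerSeries.coeff_map, seriesMon_add, seriesMon_single]
  rfl

namespace PartitionChain

variable {n : ℕ}

/-- Expanding the power produces only ring multiples of the coefficients for `ν + j e_a` with `j ≤
m`. -/
theorem coeff_seriesMon_mul_sub_pow_mem (μ : PartitionChain n) (a : ℕ) (c : SymbolRing)
    (s m : ℕ) (ν : ℕ →₀ ℕ)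
    (h : ∀ j ≤ m, μ.relBound (ν + Finsupp.single a j) < s + (ν + Finsupp.single a j).degree) :
    (seriesMon ν * (series a - PowerSeries.C c) ^ m).coeff s ∈ μ.relIdeal := by
  induction m generalizing ν with
  | zero =>
    have := h 0 le_rfl
    rw [Finsupp.single_zero, add_zero] at this
    simpa using μ.coeff_mem_relIdeal this
  | succ m ih =>
    have h1 : seriesMon ν * (series a - PowerSeries.C c) ^ (m + 1) =
        seriesMon (ν + Finsupp.single a 1) * (series a - PowerSeries.C c) ^ m -
          PowerSeries.C c * (seriesMon ν * (series a - PowerSeries.C c) ^ m) := by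
      rw [seriesMon_add, seriesMon_single]
      ring
    rw [h1, map_sub, PowerSeries.coeff_C_mul]
    refine Ideal.sub_mem _ (ih _ fun j hj => ?_)
      (Ideal.mul_mem_left _ _ (ih _ fun j hj => h j (by omega)))
    rw [add_assoc, ← Finsupp.single_add, add_comm 1 j]
    exact h (j + 1) (by omega)

theorem relIdeal_addColumn_le_comap_shiftHom (μ : PartitionChain (n + 1)) (hn : 1 ≤ n) :
    (μ.addColumn hn).relIdeal ≤ μ.relIdeal.comap (shiftHom n) := by
  refine Ideal.span_le.2 ?_
  rintro _ ⟨ν, s, hs, rfl⟩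
  rw [SetLike.mem_coe, Ideal.mem_comap]
  obtain ⟨ν, m, hν, rfl⟩ : ∃ ν' m, ν' n = 0 ∧ ν = ν' + Finsupp.single n m :=
    ⟨ν.erase n, ν n, by simp, (Finsupp.erase_add_single n ν).symm⟩
  rw [coeff_map_shiftHom_seriesMon _ _ _ _ hν]
  refine μ.coeff_seriesMon_mul_sub_pow_mem _ _ _ _ _ fun j hj => ?_
  -- Compared with `hs`, the bound grows by at most `j`, while index plus degree, now `(s + m) +
  -- (|ν| + j)`, grows by exactly `j`.
  have := μ.relBound_le_relBound_addColumn hn ν hν hj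
  rw [map_add, Finsupp.degree_single] at hs ⊢
  omega

end PartitionChain

/-! ### The monomials span -/

/-- The linear span of a set of monomials. -/
def monSpan (B : Set Mon) : Submodule ℂ SymbolRing :=
  Submodule.span ℂ ((fun m => MvPolynomial.monomial m 1) '' B)

theorem monSpan_union (B B' : Set Mon) : monSpan (B ∪ B') = monSpan B ⊔ monSpan B' := by
  rw [monSpan, Set.image_union, Submodule.span_union, monSpan, monSpan]

theorem shiftHom_mem_monSpan {a : ℕ} {B : Set Mon} {f : SymbolRing} (hf : f ∈ monSpan B) :
    shiftHom a f ∈ monSpan (shift a '' B) := by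
  have h : monSpan B ≤ (monSpan (shift a '' B)).comap (shiftHom a).toLinearMap := by
    refine Submodule.span_le.2 ?_
    rintro _ ⟨m, hm, rfl⟩
    refine Submodule.subset_span ⟨shift a m, ⟨m, hm, rfl⟩, ?_⟩
    exact (shiftHom_monomial a m 1).symm
  exact h hf

theorem exists_pderiv_eq_of_mem_monSpan {a : ℕ} {B : Set Mon} {f : SymbolRing}
    (hf : f ∈ monSpan B) :
    ∃ g ∈ monSpan (mulX0 a '' B), MvPolynomial.pderiv (a, 0) g = f := by
  have h : monSpan B ≤
      (monSpan (mulX0 a '' B)).map (MvPolynomial.pderiv (a, 0)).toLinearMap := by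
    refine Submodule.span_le.2 ?_
    rintro _ ⟨m, hm, rfl⟩
    refine ⟨((m (a, 0) + 1 : ℕ) : ℂ)⁻¹ • MvPolynomial.monomial (mulX0 a m) 1,
      Submodule.smul_mem _ _ (Submodule.subset_span ⟨_, ⟨m, hm, rfl⟩, rfl⟩), ?_⟩
    have h1 : mulX0 a m (a, 0) = m (a, 0) + 1 := by simp [mulX0, add_comm]
    have h2 : mulX0 a m - Finsupp.single (a, 0) 1 = m := by simp [mulX0]
    have h3 : ((m (a, 0) + 1 : ℕ) : ℂ) ≠ 0 := Nat.cast_ne_zero.2 (Nat.succ_ne_zero _)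
    change MvPolynomial.pderiv (a, 0) _ = _
    rw [Derivation.map_smul,
      MvPolynomial.pderiv_monomial, h1, h2, one_mul, MvPolynomial.smul_monomial, smul_eq_mul,
      inv_mul_cancel₀ h3]
  exact h hf

theorem exists_monSpan_add_relIdeal (n : ℕ) (μ : PartitionChain n) (f : SymbolRing) :
    ∃ g ∈ monSpan (basisMonomials n μ), ∃ h ∈ μ.relIdeal, f = g + h := by
  induction n, μ using PartitionChain.recursionInduction generalizing f with
  | base μ =>
    have hX : ∀ v, MvPolynomial.X v ∈ μ.relIdeal := by
      rintro ⟨a, i⟩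
      refine μ.X_mem_relIdeal ?_
      rcases Nat.eq_zero_or_pos a with rfl | ha
      · rw [μ.relBound_single_zero]
        exact Nat.zero_le _
      · rw [μ.relBound_single a ha, μ.part_of_le a ha, Nat.sub_self]
        exact Nat.zero_le _
    rw [isRecursiveFamily_basisMonomials.base]
    induction f using MvPolynomial.induction_on with
    | C c =>
      refine ⟨c • MvPolynomial.monomial 0 1, Submodule.smul_mem _ _
        (Submodule.subset_span ⟨0, rfl, rfl⟩), 0, zero_mem _, ?_⟩
      rw [add_zero, MvPolynomial.smul_monomial, smul_eq_mul, mul_one, MvPolynomial.C_apply]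
    | add p q hp hq =>
      obtain ⟨g, hg, h, hh, rfl⟩ := hp
      obtain ⟨g', hg', h', hh', rfl⟩ := hq
      exact ⟨g + g', add_mem hg hg', h + h', add_mem hh hh', by ring⟩
    | mul_X p v hp =>
      exact ⟨0, zero_mem _, _, Ideal.mul_mem_left _ p (hX v), by rw [zero_add]⟩
  | trunc n hn μ h ih =>
    rw [isRecursiveFamily_basisMonomials.trunc n hn μ h, ← μ.relIdeal_trunc hn h]
    exact ih f
  | step n hn μ hpos ih₁ ih₂ =>
    rw [isRecursiveFamily_basisMonomials.step n hn μ hpos, monSpan_union]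
    -- Both summands of `∂f` have antiderivatives of the right kind, `g` in the span of the
    -- monomials and `j` among the relations; `f - (g + j)` is then free of `x_n[0]`.
    obtain ⟨g₂, hg₂, j₂, hj₂, e₂⟩ := ih₂ (MvPolynomial.pderiv (n, 0) f)
    obtain ⟨g, hg, rfl⟩ := exists_pderiv_eq_of_mem_monSpan (a := n) hg₂
    obtain ⟨j, hj, rfl⟩ := μ.relIdeal_removeBox_le_map_pderiv hn hpos hj₂
    obtain ⟨r, hr⟩ := exists_shiftHom_eq_of_pderiv_eq_zero (a := n) (f := f - (g + j)) (by
      rw [map_sub, e₂, map_add]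
      exact sub_self _)
    obtain ⟨g₁, hg₁, j₁, hj₁, rfl⟩ := ih₁ r
    refine ⟨shiftHom n g₁ + g, Submodule.add_mem_sup (shiftHom_mem_monSpan hg₁) hg,
      shiftHom n j₁ + j, add_mem (μ.relIdeal_addColumn_le_comap_shiftHom hn hj₁) hj, ?_⟩
    rw [map_add] at hr
    linear_combination -hr

/-! ### The modules `W(n, k)` as quotients of the ring of all symbols -/

theorem natDegree_prod_pow_le {R ι : Type*} [CommRing R] (S : Finset ι) (f : ι → Polynomial R)
    (e d : ι → ℕ) (h : ∀ a ∈ S, (f a).natDegree ≤ d a) :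
    (∏ a ∈ S, f a ^ e a).natDegree ≤ ∑ a ∈ S, e a * d a :=
  (Polynomial.natDegree_prod_le _ _).trans (Finset.sum_le_sum fun a ha =>
    Polynomial.natDegree_pow_le.trans (Nat.mul_le_mul_left _ (h a ha)))

theorem reflect_pow {R : Type*} [CommRing R] (f : Polynomial R) (d e : ℕ)
    (h : f.natDegree ≤ d) :
    Polynomial.reflect (e * d) (f ^ e) = Polynomial.reflect d f ^ e := by
  induction e with
  | zero => simp [Polynomial.reflect_one]
  | succ e ih =>
    rw [pow_succ, pow_succ, add_mul, one_mul, Polynomial.reflect_mul _ _ _ h, ih]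
    exact Polynomial.natDegree_pow_le.trans (Nat.mul_le_mul_left _ h)

theorem reflect_prod_pow {R ι : Type*} [CommRing R] (S : Finset ι) (f : ι → Polynomial R)
    (e d : ι → ℕ) (h : ∀ a ∈ S, (f a).natDegree ≤ d a) :
    Polynomial.reflect (∑ a ∈ S, e a * d a) (∏ a ∈ S, f a ^ e a) =
      ∏ a ∈ S, Polynomial.reflect (d a) (f a) ^ e a := by
  classical
  induction S using Finset.induction_on with
  | empty => simp [Polynomial.reflect_one]
  | insert a S ha ih =>
    have h' : ∀ a ∈ S, (f a).natDegree ≤ d a := fun b hb => h b (Finset.mem_insert_of_mem hb)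
    have h1 := h a (Finset.mem_insert_self a S)
    rw [Finset.prod_insert ha, Finset.sum_insert ha, Finset.prod_insert ha,
      Polynomial.reflect_mul _ _ (Polynomial.natDegree_pow_le.trans (Nat.mul_le_mul_left _ h1))
        (natDegree_prod_pow_le S f e d h'), reflect_pow _ _ _ h1, ih h']

namespace Datum

variable {n : ℕ} (D : Datum n)

theorem diff_chain (b j : ℕ) :
    D.chain.diff b j = ∑ p, if D.nn p = b + 1 ∧ j < D.kk p then 1 else 0 := by
  rw [← Finset.card_filter, PartitionChain.diff]
  simp only [chain]
  rw [← Finset.card_sdiff_of_subset]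
  · congr 1
    ext p
    simp only [Finset.mem_sdiff, Finset.mem_filter, Finset.mem_univ, true_and]
    omega
  · intro p
    simp only [Finset.mem_filter, Finset.mem_univ, true_and]
    omega

theorem relBound_chain (ν : ℕ →₀ ℕ) :
    D.chain.relBound ν = ∑ p, min (partialSum ν (D.nn p)) (D.kk p) := by
  simp only [PartitionChain.relBound, diff_chain]
  rw [Finset.sum_congr rfl fun b _ => Finset.sum_comm, Finset.sum_comm]
  refine Finset.sum_congr rfl fun p _ => ?_
  have h1 := D.one_le p
  have h2 := D.le p
  rw [Finset.sum_eq_single (D.nn p - 1)]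
  · rw [Nat.sub_add_cancel h1]
    simp only [true_and]
    rw [← Finset.card_filter]
    have : Finset.filter (fun j => j < D.kk p) (Finset.range (partialSum ν (D.nn p))) =
        Finset.range (min (partialSum ν (D.nn p)) (D.kk p)) := by
      ext j
      simp
    rw [this, Finset.card_range]
  · intro b _ hb
    refine Finset.sum_eq_zero fun j _ => ?_
    rw [if_neg (by omega)]
  · intro h
    exact absurd (Finset.mem_range.2 (by omega)) h

/-- For each `p` one has `(S - k)_+ + min(S, k) = S`, and `ν_a` is counted once for every `p` with
`n_p > a`. -/
theorem ordBound_add_relBound (ν : ℕ →₀ ℕ) (hν : ν.support ⊆ Finset.Ico 1 n) :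
    D.ordBound ν + D.chain.relBound ν = ∑ a ∈ ν.support, ν a * D.Ncard a := by
  rw [relBound_chain, ordBound, ← Finset.sum_add_distrib]
  have h1 : ∀ p, (∑ a ∈ Finset.Ico 1 (D.nn p), ν a) - D.kk p +
      min (partialSum ν (D.nn p)) (D.kk p) = ∑ a ∈ ν.support, if a < D.nn p then ν a else 0 := by
    intro p
    have h2 : ∑ a ∈ ν.support, (if a < D.nn p then ν a else 0) = partialSum ν (D.nn p) := by
      rw [partialSum, ← Finset.sum_filter]
      refine Finset.sum_subset ?_ ?_
      · intro a ha
        rw [Finset.mem_filter] at ha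
        have := Finset.mem_Ico.1 (hν ha.1)
        exact Finset.mem_Ico.2 ⟨this.1, ha.2⟩
      · intro a ha ha'
        rw [Finset.mem_filter] at ha'
        by_contra h
        exact ha' ⟨Finsupp.mem_support_iff.2 h, (Finset.mem_Ico.1 ha).2⟩
    rw [h2, ← partialSum]
    omega
  rw [Finset.sum_congr rfl fun p _ => h1 p, Finset.sum_comm]
  refine Finset.sum_congr rfl fun a _ => ?_
  rw [← Finset.sum_filter, Finset.sum_const, smul_eq_mul, mul_comm, Ncard]

theorem x_eq_zero {a i : ℕ} (h : (a, i) ∉ D.vars) : D.x a i = 0 := dif_neg h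

theorem coeff_current (a j : ℕ) :
    (D.current a).coeff j = if j < D.Ncard a then D.x a (D.Ncard a - 1 - j) else 0 := by
  rw [current, Polynomial.finsetSum_coeff]
  simp only [Polynomial.coeff_C_mul_X_pow]
  split_ifs with h
  · rw [Finset.sum_eq_single (D.Ncard a - 1 - j)]
    · rw [if_pos (by omega)]
    · intro i hi hij
      have := Finset.mem_range.1 hi
      rw [if_neg (by omega)]
    · intro hi
      exact absurd (Finset.mem_range.2 (by omega)) hi
  · refine Finset.sum_eq_zero fun i hi => ?_
    have := Finset.mem_range.1 hi
    rw [if_neg (by omega)]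

theorem natDegree_current_le (a : ℕ) : (D.current a).natDegree ≤ D.Ncard a - 1 := by
  rw [Polynomial.natDegree_le_iff_coeff_eq_zero]
  intro j hj
  rw [coeff_current, if_neg (by omega)]

theorem current_eq_zero {a : ℕ} (h : ¬(1 ≤ a ∧ a < n ∧ 0 < D.Ncard a)) : D.current a = 0 := by
  ext1 j
  rw [coeff_current, Polynomial.coeff_zero]
  split_ifs with hj
  · refine D.x_eq_zero fun hv => h ?_
    obtain ⟨h1, h2, -⟩ := hv
    exact ⟨h1, h2, by omega⟩
  · rfl

/-- The substitution sending the symbol `x_a[i]` to the indeterminate `x_a[i]` of `R`, or to `0`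
if there is none. -/
def symbolHom : SymbolRing →ₐ[ℂ] D.R := MvPolynomial.aeval fun v => D.x v.1 v.2

theorem symbolHom_X (a i : ℕ) : D.symbolHom (MvPolynomial.X (a, i)) = D.x a i :=
  MvPolynomial.aeval_X _ _

theorem map_symbolHom_series (a : ℕ) :
    PowerSeries.map (D.symbolHom : SymbolRing →+* D.R) (series a) =
      (Polynomial.reflect (D.Ncard a - 1) (D.current a) : PowerSeries D.R) := by
  ext1 s
  rw [PowerSeries.coeff_map, series, PowerSeries.coeff_mk, Polynomial.coeff_coe,
    Polynomial.coeff_reflect, coeff_current]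
  refine (D.symbolHom_X a s).trans ?_
  have hs : D.Ncard a ≤ s → D.x a s = 0 := fun h => D.x_eq_zero fun hv => by
    have : s < D.Ncard a := hv.2.2
    omega
  by_cases h : s ≤ D.Ncard a - 1
  · rw [Polynomial.revAt_le h]
    split_ifs with h'
    · congr 1
      omega
    · exact hs (by omega)
  · rw [Polynomial.revAt_eq_self_of_lt (by omega), if_neg (by omega), hs (by omega)]

theorem symbolHom_coeff_seriesMon (ν : ℕ →₀ ℕ) (s : ℕ) :
    D.symbolHom ((seriesMon ν).coeff s) = (∏ a ∈ ν.support, D.current a ^ ν a).coeff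
      (Polynomial.revAt (∑ a ∈ ν.support, ν a * (D.Ncard a - 1)) s) := by
  have h : PowerSeries.map (D.symbolHom : SymbolRing →+* D.R) (seriesMon ν) =
      (Polynomial.reflect (∑ a ∈ ν.support, ν a * (D.Ncard a - 1))
        (∏ a ∈ ν.support, D.current a ^ ν a) : PowerSeries D.R) := by
    rw [reflect_prod_pow _ _ _ _ fun a _ => D.natDegree_current_le a, seriesMon, Finsupp.prod,
      map_prod, ← Polynomial.coeToPowerSeries.ringHom_apply, map_prod]
    refine Finset.prod_congr rfl fun a _ => ?_
    rw [map_pow, map_pow, map_symbolHom_series, Polynomial.coeToPowerSeries.ringHom_apply]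
  have h2 := congrArg (PowerSeries.coeff s) h
  rw [PowerSeries.coeff_map, Polynomial.coeff_coe, Polynomial.coeff_reflect] at h2
  exact h2

/-- With `j + s = ∑ ν_a (N_a - 1)`, this makes `j < ordBound` equivalent to `relBound < s + |ν|`.
Positivity of `N_a` guards the truncated subtraction; otherwise the product of currents is zero
anyway. -/
theorem sum_add_degree (ν : ℕ →₀ ℕ)
    (hν : ∀ a ∈ ν.support, 1 ≤ a ∧ a < n ∧ 0 < D.Ncard a) :
    ∑ a ∈ ν.support, ν a * (D.Ncard a - 1) + ν.degree =
      D.ordBound ν + D.chain.relBound ν := by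
  rw [D.ordBound_add_relBound ν fun a ha => Finset.mem_Ico.2 ⟨(hν a ha).1, (hν a ha).2.1⟩,
    Finsupp.degree_apply, ← Finset.sum_add_distrib]
  refine Finset.sum_congr rfl fun a ha => ?_
  obtain ⟨N, hN⟩ : ∃ N, D.Ncard a = N + 1 := ⟨D.Ncard a - 1, by have := (hν a ha).2.2; omega⟩
  rw [hN, Nat.add_sub_cancel, mul_add, mul_one]

theorem prod_current_eq_zero {ν : ℕ → ℕ} {S : Finset ℕ}
    (hν : ¬∀ a ∈ S, ν a ≠ 0 → 1 ≤ a ∧ a < n ∧ 0 < D.Ncard a) :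
    ∏ a ∈ S, D.current a ^ ν a = 0 := by
  push Not at hν
  obtain ⟨a, ha, h0, h⟩ := hν
  refine Finset.prod_eq_zero ha ?_
  rw [D.current_eq_zero (by omega), zero_pow h0]

theorem symbolHom_mem_J {f : SymbolRing} (hf : f ∈ D.chain.relIdeal) : D.symbolHom f ∈ D.J := by
  suffices h : D.chain.relIdeal ≤ D.J.comap D.symbolHom from h hf
  refine Ideal.span_le.2 ?_
  rintro _ ⟨ν, s, hs, rfl⟩
  rw [SetLike.mem_coe, Ideal.mem_comap, symbolHom_coeff_seriesMon]
  by_cases hν : ∀ a ∈ ν.support, ν a ≠ 0 → 1 ≤ a ∧ a < n ∧ 0 < D.Ncard a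
  · replace hν : ∀ a ∈ ν.support, 1 ≤ a ∧ a < n ∧ 0 < D.Ncard a :=
      fun a ha => hν a ha (Finsupp.mem_support_iff.1 ha)
    have h1 := D.sum_add_degree ν hν
    by_cases hsM : s ≤ ∑ a ∈ ν.support, ν a * (D.Ncard a - 1)
    · rw [Polynomial.revAt_le hsM]
      refine Ideal.subset_span
        ⟨ν, ∑ a ∈ ν.support, ν a * (D.Ncard a - 1) - s, by omega, ?_⟩
      congr 1
      refine Finset.prod_subset (fun a ha => Finset.mem_Ico.2 ⟨(hν a ha).1, (hν a ha).2.1⟩) ?_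
      intro a _ ha
      rw [Finsupp.notMem_support_iff.1 ha, pow_zero]
    · rw [Polynomial.revAt_eq_self_of_lt (by omega), Polynomial.coeff_eq_zero_of_natDegree_lt]
      · exact zero_mem _
      · have := natDegree_prod_pow_le ν.support D.current ν _ fun a _ => D.natDegree_current_le a
        omega
  · rw [D.prod_current_eq_zero hν, Polynomial.coeff_zero]
    exact zero_mem _

theorem J_le_map_symbolHom : D.J ≤ D.chain.relIdeal.map D.symbolHom := by
  refine Ideal.span_le.2 ?_
  rintro _ ⟨ν₀, j, hj, rfl⟩
  obtain ⟨ν, hνn, hν₀⟩ : ∃ ν : ℕ →₀ ℕ, ν.support ⊆ Finset.Ico 1 n ∧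
      ∀ a ∈ Finset.Ico 1 n, ν a = ν₀ a := by
    refine ⟨Finsupp.onFinset (Finset.Ico 1 n) (fun a => if a ∈ Finset.Ico 1 n then ν₀ a else 0)
      (fun a ha => by_contra fun h => ha (if_neg h)), Finsupp.support_onFinset_subset, ?_⟩
    intro a ha
    rw [Finsupp.onFinset_apply, if_pos ha]
  have hord : D.ordBound ν₀ = D.ordBound ν := by
    refine Finset.sum_congr rfl fun p _ => ?_
    congr 1
    refine Finset.sum_congr rfl fun a ha => (hν₀ a ?_).symm
    have := D.le p
    rw [Finset.mem_Ico] at ha ⊢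
    omega
  have hprod : ∏ a ∈ Finset.Ico 1 n, D.current a ^ ν₀ a =
      ∏ a ∈ ν.support, D.current a ^ ν a := by
    rw [Finset.prod_congr rfl fun a ha => by rw [← hν₀ a ha]]
    refine (Finset.prod_subset hνn fun a _ ha => ?_).symm
    rw [Finsupp.notMem_support_iff.1 ha, pow_zero]
  rw [hord] at hj
  rw [hprod, SetLike.mem_coe]
  by_cases hν : ∀ a ∈ ν.support, ν a ≠ 0 → 1 ≤ a ∧ a < n ∧ 0 < D.Ncard a
  · have h1 := D.sum_add_degree ν fun a ha => hν a ha (Finsupp.mem_support_iff.1 ha)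
    by_cases hjM : j ≤ ∑ a ∈ ν.support, ν a * (D.Ncard a - 1)
    · have h2 := D.symbolHom_coeff_seriesMon ν (∑ a ∈ ν.support, ν a * (D.Ncard a - 1) - j)
      rw [Polynomial.revAt_le (Nat.sub_le _ _), Nat.sub_sub_self hjM] at h2
      rw [← h2]
      exact Ideal.mem_map_of_mem _ (D.chain.coeff_mem_relIdeal (by omega))
    · rw [Polynomial.coeff_eq_zero_of_natDegree_lt]
      · exact zero_mem _
      · have := natDegree_prod_pow_le ν.support D.current ν _ fun a _ => D.natDegree_current_le a
        omega
  · rw [D.prod_current_eq_zero hν, Polynomial.coeff_zero]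
    exact zero_mem _

theorem X_mem_relIdeal_of_notMem_vars {v : ℕ × ℕ} (hv : v ∉ D.vars) :
    MvPolynomial.X v ∈ D.chain.relIdeal := by
  obtain ⟨a, i⟩ := v
  refine D.chain.X_mem_relIdeal ?_
  rcases Nat.eq_zero_or_pos a with rfl | ha
  · rw [PartitionChain.relBound_single_zero]
    exact Nat.zero_le _
  rcases le_or_gt n a with han | han
  · rw [PartitionChain.relBound_single _ _ ha, D.chain.part_of_le a han, Nat.sub_self]
    exact Nat.zero_le _
  have hi : D.Ncard a ≤ i := by
    by_contra h
    exact hv ⟨ha, han, Nat.lt_of_not_le h⟩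
  refine le_trans ?_ hi
  rw [relBound_chain, Ncard, Finset.card_filter]
  refine Finset.sum_le_sum fun p _ => ?_
  have := partialSum_add_single 0 a 1 (D.nn p)
  rw [zero_add] at this
  rw [this]
  have h0 : partialSum 0 (D.nn p) = 0 := by simp [partialSum]
  split_ifs <;> omega

/-- The inclusion of `R` in the ring of all symbols. -/
def inclusion : D.R →ₐ[ℂ] SymbolRing := MvPolynomial.rename Subtype.val

theorem symbolHom_inclusion (f : D.R) : D.symbolHom (D.inclusion f) = f := by
  have : D.symbolHom.comp D.inclusion = AlgHom.id ℂ D.R := by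
    ext1 ⟨⟨a, i⟩, hv⟩
    simp [inclusion, symbolHom, x, hv]
  exact DFunLike.congr_fun this f

theorem sub_inclusion_symbolHom_mem (f : SymbolRing) :
    f - D.inclusion (D.symbolHom f) ∈ D.chain.relIdeal := by
  have : (Ideal.Quotient.mkₐ ℂ D.chain.relIdeal).comp (D.inclusion.comp D.symbolHom) =
      Ideal.Quotient.mkₐ ℂ D.chain.relIdeal := by
    ext1 ⟨a, i⟩
    by_cases hv : (a, i) ∈ D.vars
    · simp [inclusion, symbolHom, x, hv]
    · rw [AlgHom.comp_apply, AlgHom.comp_apply, symbolHom_X, D.x_eq_zero hv, map_zero, map_zero]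
      exact (Ideal.Quotient.eq_zero_iff_mem.2 (D.X_mem_relIdeal_of_notMem_vars hv)).symm
  exact Ideal.Quotient.eq.1 (DFunLike.congr_fun this f).symm

/-- The kernel of `symbolHom` consists of relations, as the symbols outside the index set are
relations themselves. So `W(n, k)` is the ring of symbols modulo an ideal determined by the chain.
-/
theorem symbolHom_mem_J_iff {f : SymbolRing} : D.symbolHom f ∈ D.J ↔ f ∈ D.chain.relIdeal := by
  refine ⟨fun h => ?_, D.symbolHom_mem_J⟩
  obtain ⟨g, hg, hgf⟩ := (Ideal.mem_map_iff_of_surjective D.symbolHom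
    fun r => ⟨_, D.symbolHom_inclusion r⟩).1 (D.J_le_map_symbolHom h)
  have h1 := D.sub_inclusion_symbolHom_mem (f - g)
  rw [map_sub, hgf, sub_self, map_zero, sub_zero] at h1
  simpa using add_mem h1 hg

/-- The map from the ring of all symbols to `W(n, k)`. -/
def toW : SymbolRing →ₐ[ℂ] D.W := (Ideal.Quotient.mkₐ ℂ D.J).comp D.symbolHom

theorem toW_X (a i : ℕ) : D.toW (MvPolynomial.X (a, i)) = D.gen a i := by
  rw [toW, AlgHom.comp_apply, symbolHom_X]
  rfl

theorem toW_monomial (m : Mon) : D.toW (MvPolynomial.monomial m 1) = D.mon m := by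
  rw [MvPolynomial.monomial_eq, map_one, one_mul, mon, Finsupp.prod, Finsupp.prod, map_prod]
  exact Finset.prod_congr rfl fun v _ => by rw [map_pow, toW_X]

theorem toW_surjective : Function.Surjective D.toW :=
  (Ideal.Quotient.mkₐ_surjective ℂ D.J).comp fun r => ⟨_, D.symbolHom_inclusion r⟩

theorem toW_eq_zero_iff {f : SymbolRing} : D.toW f = 0 ↔ f ∈ D.chain.relIdeal :=
  Ideal.Quotient.eq_zero_iff_mem.trans D.symbolHom_mem_J_iff

end Datum

/-! ### Weights -/

/-- The weight of a monomial, where `x_a[i]` has weight `i`. -/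
def monWeight : Mon →+ ℕ := Finsupp.weight (Prod.snd : ℕ × ℕ → ℕ)

/-- The space of polynomials all of whose monomials have weight less than `d`. -/
def lowWeight (d : ℕ) : Submodule ℂ SymbolRing :=
  MvPolynomial.restrictSupport ℂ {m | monWeight m < d}

theorem mem_lowWeight_of_isWeightedHomogeneous {f : SymbolRing} {i d : ℕ} (hi : i < d)
    (hf : MvPolynomial.IsWeightedHomogeneous (Prod.snd : ℕ × ℕ → ℕ) f i) : f ∈ lowWeight d := by
  rw [lowWeight, MvPolynomial.mem_restrictSupport_iff]
  intro m hm
  have := hf (MvPolynomial.mem_support_iff.1 hm)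
  exact lt_of_eq_of_lt this hi

theorem monomial_mul_mem_lowWeight {f : SymbolRing} {s : ℕ} (hf : f ∈ lowWeight s) (u : Mon)
    (c : ℂ) : MvPolynomial.monomial u c * f ∈ lowWeight (monWeight u + s) := by
  rw [lowWeight, MvPolynomial.restrictSupport_eq_span] at hf
  refine Submodule.span_induction (p := fun f _ => MvPolynomial.monomial u c * f ∈
    lowWeight (monWeight u + s)) ?_ ?_ ?_ ?_ hf
  · rintro _ ⟨m, hm, rfl⟩
    rw [MvPolynomial.monomial_mul, lowWeight, MvPolynomial.monomial_mem_restrictSupport]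
    left
    rw [Set.mem_ofPred_eq] at hm ⊢
    rw [map_add]
    omega
  · rw [mul_zero]
    exact zero_mem _
  · intro x y _ _ hx hy
    rw [mul_add]
    exact add_mem hx hy
  · intro a x _ hx
    rw [mul_smul_comm]
    exact Submodule.smul_mem _ _ hx

theorem isWeightedHomogeneous_coeff_mul {f g : PowerSeries SymbolRing}
    (hf : ∀ s, MvPolynomial.IsWeightedHomogeneous (Prod.snd : ℕ × ℕ → ℕ) (f.coeff s) s)
    (hg : ∀ s, MvPolynomial.IsWeightedHomogeneous (Prod.snd : ℕ × ℕ → ℕ) (g.coeff s) s) (s : ℕ) :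
    MvPolynomial.IsWeightedHomogeneous (Prod.snd : ℕ × ℕ → ℕ) ((f * g).coeff s) s := by
  rw [PowerSeries.coeff_mul]
  refine MvPolynomial.IsWeightedHomogeneous.sum _ _ _ fun v hv => ?_
  rw [← Finset.HasAntidiagonal.mem_antidiagonal.1 hv]
  exact (hf _).mul (hg _)

theorem isWeightedHomogeneous_coeff_one (s : ℕ) :
    MvPolynomial.IsWeightedHomogeneous (Prod.snd : ℕ × ℕ → ℕ)
      ((1 : PowerSeries SymbolRing).coeff s) s := by
  rw [PowerSeries.coeff_one]
  split_ifs with h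
  · subst h
    exact MvPolynomial.isWeightedHomogeneous_one ℂ _
  · exact MvPolynomial.isWeightedHomogeneous_zero ℂ _ _

theorem isWeightedHomogeneous_coeff_seriesMon (ν : ℕ →₀ ℕ) (s : ℕ) :
    MvPolynomial.IsWeightedHomogeneous (Prod.snd : ℕ × ℕ → ℕ) ((seriesMon ν).coeff s) s := by
  have hser : ∀ a s, MvPolynomial.IsWeightedHomogeneous (Prod.snd : ℕ × ℕ → ℕ)
      ((series a).coeff s) s := by
    intro a s
    rw [series, PowerSeries.coeff_mk]
    exact MvPolynomial.isWeightedHomogeneous_X ℂ Prod.snd (a, s)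
  refine Finset.prod_induction _ (fun f : PowerSeries SymbolRing => ∀ s,
    MvPolynomial.IsWeightedHomogeneous (Prod.snd : ℕ × ℕ → ℕ) (f.coeff s) s)
    (fun f g => isWeightedHomogeneous_coeff_mul) isWeightedHomogeneous_coeff_one ?_ s
  intro a _
  change ∀ s, MvPolynomial.IsWeightedHomogeneous _ ((series a ^ ν a).coeff s) s
  induction ν a with
  | zero => rw [pow_zero]; exact isWeightedHomogeneous_coeff_one
  | succ e ih => rw [pow_succ]; exact isWeightedHomogeneous_coeff_mul ih (hser a)

/-- A set of monomials which spans modulo the relations also spans modulo any ideal containing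
deformations of the relations by terms of lower weight. -/
theorem top_le_monSpan_sup_of_deformation {n : ℕ} (μ : PartitionChain n) (I : Ideal SymbolRing)
    (hI : ∀ (ν : ℕ →₀ ℕ) (s : ℕ), μ.relBound ν < s + ν.degree →
      ∃ g ∈ I, (seriesMon ν).coeff s - g ∈ lowWeight s)
    (S : Set Mon) (hS : ∀ f, ∃ g ∈ monSpan S, ∃ h ∈ μ.relIdeal, f = g + h) :
    ⊤ ≤ monSpan S ⊔ I.restrictScalars ℂ := by
  set T := monSpan S ⊔ I.restrictScalars ℂ with hT
  -- The relations are homogeneous, so a component of weight `d` is a sum of monomial multiples of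
  -- relations in weight `d`. Modulo `I`, each of these equals something of lower weight.
  have key : ∀ d, lowWeight d ≤ T → ∀ f ∈ μ.relIdeal,
      MvPolynomial.weightedHomogeneousComponent (Prod.snd : ℕ × ℕ → ℕ) d f ∈ T := by
    intro d hd
    refine ideal_span_le_of_mul_mem
      (T.comap (MvPolynomial.weightedHomogeneousComponent (Prod.snd : ℕ × ℕ → ℕ) d)) ?_
    rintro _ ⟨ν, s, hs, rfl⟩ u c
    rw [Submodule.mem_comap]
    have hom : MvPolynomial.IsWeightedHomogeneous (Prod.snd : ℕ × ℕ → ℕ)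
        (MvPolynomial.monomial u c * (seriesMon ν).coeff s) (monWeight u + s) :=
      (MvPolynomial.isWeightedHomogeneous_monomial _ _ _ rfl).mul
        (isWeightedHomogeneous_coeff_seriesMon ν s)
    by_cases hds : monWeight u + s = d
    · rw [hds] at hom
      rw [hom.weightedHomogeneousComponent_same]
      obtain ⟨g, hg, hlow⟩ := hI ν s hs
      have h1 := monomial_mul_mem_lowWeight hlow u c
      rw [hds] at h1
      have h2 : MvPolynomial.monomial u c * g ∈ T :=
        (le_sup_right : _ ≤ T) (I.mul_mem_left _ hg)
      have := T.add_mem (hd h1) h2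
      rwa [mul_sub, sub_add_cancel] at this
    · rw [hom.weightedHomogeneousComponent_ne _ (Ne.symm hds)]
      exact T.zero_mem
  have hcomp : ∀ d, ∀ g ∈ monSpan S,
      MvPolynomial.weightedHomogeneousComponent (Prod.snd : ℕ × ℕ → ℕ) d g ∈ monSpan S := by
    intro d
    suffices h : monSpan S ≤ (monSpan S).comap
        (MvPolynomial.weightedHomogeneousComponent (Prod.snd : ℕ × ℕ → ℕ) d) from fun g hg => h hg
    refine Submodule.span_le.2 ?_
    rintro _ ⟨m, hm, rfl⟩
    rw [SetLike.mem_coe, Submodule.mem_comap]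
    have hom : MvPolynomial.IsWeightedHomogeneous (Prod.snd : ℕ × ℕ → ℕ)
        (MvPolynomial.monomial m (1 : ℂ)) (monWeight m) :=
      MvPolynomial.isWeightedHomogeneous_monomial _ _ _ rfl
    by_cases hd : monWeight m = d
    · rw [hd] at hom
      rw [hom.weightedHomogeneousComponent_same]
      exact Submodule.subset_span ⟨m, hm, rfl⟩
    · rw [hom.weightedHomogeneousComponent_ne _ (Ne.symm hd)]
      exact zero_mem _
  have hlow : ∀ d, lowWeight d ≤ T := by
    intro d
    induction d with
    | zero =>
      rw [lowWeight, MvPolynomial.restrictSupport_eq_span]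
      simp
    | succ d ih =>
      rw [lowWeight, MvPolynomial.restrictSupport_eq_span]
      refine Submodule.span_le.2 ?_
      rintro _ ⟨m, hm, rfl⟩
      rcases Nat.lt_succ_iff_lt_or_eq.1 hm with hm | hm
      · exact ih ((MvPolynomial.monomial_mem_restrictSupport ℂ).2 (Or.inl hm))
      · obtain ⟨g, hg, h, hh, e⟩ := hS (MvPolynomial.monomial m 1)
        have hom : MvPolynomial.IsWeightedHomogeneous (Prod.snd : ℕ × ℕ → ℕ)
            (MvPolynomial.monomial m (1 : ℂ)) d :=
          MvPolynomial.isWeightedHomogeneous_monomial _ _ _ hm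
        have h1 := T.add_mem ((le_sup_left : _ ≤ T) (hcomp d g hg)) (key d ih h hh)
        rwa [← map_add, ← e, hom.weightedHomogeneousComponent_same] at h1
  intro f _
  refine hlow (f.support.sup monWeight + 1) ?_
  rw [lowWeight, MvPolynomial.mem_restrictSupport_iff]
  intro m hm
  exact Nat.lt_succ_of_le (Finset.le_sup (f := monWeight) hm)

/-! ### The tensor product of truncated polynomial rings -/

theorem mapDomain_apply_eq_sum {α β : Type*} [DecidableEq β] (f : α → β) (u : α →₀ ℕ) (x : β) :
    u.mapDomain f x = ∑ v ∈ u.support, if f v = x then u v else 0 := by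
  rw [Finsupp.mapDomain, Finsupp.sum_apply, Finsupp.sum]
  simp only [Finsupp.single_apply]

namespace Datum

variable {n : ℕ} (D : Datum n)

/-- The exponents `β` of the monomials `∏ y_{a,p}^{β(a,p)}` which form a basis of the tensor
product over `p` of the rings `ℂ[y_1, …, y_{n_p - 1}]`, truncated in degrees above `k_p`. -/
def box : Set (ℕ × Fin D.N →₀ ℕ) :=
  {β | (∀ v ∈ β.support, 1 ≤ v.1 ∧ v.1 < D.nn v.2) ∧ ∀ p, β.mapDomain Prod.snd p ≤ D.kk p}

theorem isUpperSet_compl_box : IsUpperSet D.boxᶜ := by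
  intro β β' h hβ hβ'
  refine hβ ⟨fun v hv => hβ'.1 v (Finsupp.support_mono h hv), fun p => ?_⟩
  obtain ⟨γ, rfl⟩ := le_iff_exists_add.1 h
  have := hβ'.2 p
  rw [Finsupp.mapDomain_add, Finsupp.add_apply] at this
  omega

/-- The monomial ideal spanned by the monomials outside `box`. -/
def boxIdeal : Ideal (MvPolynomial (ℕ × Fin D.N) ℂ) :=
  MvPolynomial.restrictSupportIdeal ℂ D.boxᶜ D.isUpperSet_compl_box

theorem mem_boxIdeal_iff {f : MvPolynomial (ℕ × Fin D.N) ℂ} :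
    f ∈ D.boxIdeal ↔ ∀ β ∈ D.box, f.coeff β = 0 := by
  change f ∈ MvPolynomial.restrictSupport ℂ D.boxᶜ ↔ _
  rw [MvPolynomial.mem_restrictSupport_iff]
  constructor
  · intro h β hβ
    by_contra hc
    exact h (MvPolynomial.mem_support_iff.2 hc) hβ
  · intro h β hβ hβ'
    exact MvPolynomial.mem_support_iff.1 hβ (h β hβ')

/-- The geometric series `1 / (1 - p t)`. -/
def geom (p : Fin D.N) : PowerSeries (MvPolynomial (ℕ × Fin D.N) ℂ) :=
  PowerSeries.mk fun i => MvPolynomial.C ((p : ℂ) ^ i)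

/-- The polynomial `1 - p t`. -/
def den (p : Fin D.N) : Polynomial ℂ := 1 - Polynomial.C (p : ℂ) * Polynomial.X

theorem natDegree_den_le (p : Fin D.N) : (D.den p).natDegree ≤ 1 := by
  rw [den]
  compute_degree

theorem geom_mul_den (p : Fin D.N) :
    D.geom p * (((D.den p).map MvPolynomial.C : Polynomial (MvPolynomial (ℕ × Fin D.N) ℂ)) :
      PowerSeries (MvPolynomial (ℕ × Fin D.N) ℂ)) = 1 := by
  rw [geom, den]
  generalize ((p : ℕ) : ℂ) = z
  have h : (((1 - Polynomial.C z * Polynomial.X : Polynomial ℂ).map MvPolynomial.C :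
      Polynomial (MvPolynomial (ℕ × Fin D.N) ℂ)) : PowerSeries (MvPolynomial (ℕ × Fin D.N) ℂ)) =
      1 - PowerSeries.X * PowerSeries.C (MvPolynomial.C z) := by
    simp only [Polynomial.map_sub, Polynomial.map_one, Polynomial.map_mul, Polynomial.map_C,
      Polynomial.map_X, Polynomial.coe_sub, Polynomial.coe_one, Polynomial.coe_mul,
      Polynomial.coe_C, Polynomial.coe_X]
    ring
  rw [h, mul_sub, mul_one, mul_left_comm]
  ext1 s
  cases s with
  | zero => simp
  | succ s =>
    simp [PowerSeries.coeff_succ_X_mul, PowerSeries.coeff_mul_C, pow_succ, PowerSeries.coeff_one]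

/-- The homomorphism sending `x_a[i]` to `∑ p ^ i y_{a,p}`, the sum over all `p` with
`a < n_p`. -/
def pointHom : SymbolRing →ₐ[ℂ] MvPolynomial (ℕ × Fin D.N) ℂ :=
  MvPolynomial.aeval fun v => ∑ p, if 1 ≤ v.1 ∧ v.1 < D.nn p then
    MvPolynomial.C ((p : ℂ) ^ v.2) * MvPolynomial.X (v.1, p) else 0

/-- The linear form `∑ y_{a,p}`, the sum over all `p` with `a < n_p`. -/
def linForm (a : ℕ) : MvPolynomial (ℕ × Fin D.N) ℂ :=
  ∑ p, if 1 ≤ a ∧ a < D.nn p then MvPolynomial.X (a, p) else 0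

/-- The product of powers of the linear forms. -/
def linFormMon (ν : ℕ →₀ ℕ) : MvPolynomial (ℕ × Fin D.N) ℂ := ν.prod fun a e => D.linForm a ^ e

/-- The substitution `y_{a,p} ↦ y_{a,p} / (1 - p t)`. -/
def twist : MvPolynomial (ℕ × Fin D.N) ℂ →+* PowerSeries (MvPolynomial (ℕ × Fin D.N) ℂ) :=
  MvPolynomial.eval₂Hom ((PowerSeries.C).comp MvPolynomial.C)
    fun v => D.geom v.2 * PowerSeries.C (MvPolynomial.X v)

theorem map_pointHom_seriesMon (ν : ℕ →₀ ℕ) :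
    PowerSeries.map (D.pointHom : SymbolRing →+* MvPolynomial (ℕ × Fin D.N) ℂ) (seriesMon ν) =
      D.twist (D.linFormMon ν) := by
  have h : ∀ a, PowerSeries.map (D.pointHom : SymbolRing →+* MvPolynomial (ℕ × Fin D.N) ℂ)
      (series a) = D.twist (D.linForm a) := by
    intro a
    ext1 s
    rw [linForm, map_sum, map_sum, PowerSeries.coeff_map, series, PowerSeries.coeff_mk]
    simp only [pointHom, RingHom.coe_coe, MvPolynomial.aeval_X]
    refine Finset.sum_congr rfl fun p _ => ?_
    split_ifs
    · simp [twist, geom]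
    · simp
  rw [seriesMon, linFormMon, Finsupp.prod, Finsupp.prod, map_prod, map_prod]
  exact Finset.prod_congr rfl fun a _ => by rw [map_pow, map_pow, h]

theorem mapDomain_fst_of_mem_support_linFormMon {ν : ℕ →₀ ℕ} {β : ℕ × Fin D.N →₀ ℕ}
    (h : β ∈ (D.linFormMon ν).support) : β.mapDomain Prod.fst = ν := by
  have hom : MvPolynomial.IsWeightedHomogeneous
      (fun v : ℕ × Fin D.N => Finsupp.single v.1 1) (D.linFormMon ν) ν := by
    have h1 : ∀ a, MvPolynomial.IsWeightedHomogeneous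
        (fun v : ℕ × Fin D.N => Finsupp.single v.1 1) (D.linForm a) (Finsupp.single a 1) := by
      intro a
      refine MvPolynomial.IsWeightedHomogeneous.sum _ _ _ fun p _ => ?_
      split_ifs
      · exact MvPolynomial.isWeightedHomogeneous_X ℂ
          (fun v : ℕ × Fin D.N => Finsupp.single v.1 1) (a, p)
      · exact MvPolynomial.isWeightedHomogeneous_zero ℂ _ _
    have h2 := MvPolynomial.IsWeightedHomogeneous.prod ν.support (fun a => D.linForm a ^ ν a)
      (fun a => ν a • Finsupp.single a 1) fun a _ => (h1 a).pow (ν a)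
    have h3 : ∑ a ∈ ν.support, ν a • Finsupp.single a 1 = ν := by
      simpa [Finsupp.sum] using Finsupp.sum_single ν
    rw [h3] at h2
    exact h2
  have := hom (MvPolynomial.mem_support_iff.1 h)
  rw [Finsupp.weight_apply] at this
  simpa [Finsupp.mapDomain] using this

theorem twist_monomial (β : ℕ × Fin D.N →₀ ℕ) (c : ℂ) :
    D.twist (MvPolynomial.monomial β c) = PowerSeries.C (MvPolynomial.monomial β c) *
      (β.mapDomain Prod.snd).prod fun p e => D.geom p ^ e := by
  rw [twist, MvPolynomial.coe_eval₂Hom, MvPolynomial.eval₂_monomial,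
    Finsupp.prod_mapDomain_index (by simp) (fun _ _ _ => pow_add _ _ _),
    MvPolynomial.monomial_eq, map_mul, RingHom.comp_apply, mul_assoc]
  congr 1
  simp only [Finsupp.prod, mul_pow, Finset.prod_mul_distrib, map_prod, map_pow]
  rw [mul_comm]

/-- The common denominator `∏ (1 - p t)^{min(ν_1 + ⋯ + ν_{n_p - 1}, k_p)}`. -/
def commonDen (ν : ℕ →₀ ℕ) : Polynomial ℂ :=
  ∏ p, D.den p ^ min (partialSum ν (D.nn p)) (D.kk p)

theorem mapDomain_snd_le_partialSum {β : ℕ × Fin D.N →₀ ℕ} (hβ : β ∈ D.box) (p : Fin D.N) :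
    β.mapDomain Prod.snd p ≤ partialSum (β.mapDomain Prod.fst) (D.nn p) := by
  simp only [partialSum, mapDomain_apply_eq_sum]
  rw [Finset.sum_comm]
  refine Finset.sum_le_sum fun v hv => ?_
  have := hβ.1 v hv
  rw [Finset.sum_ite_eq]
  split_ifs with h1 h2
  · exact le_rfl
  · subst h1
    exact absurd (Finset.mem_Ico.2 this) h2
  · exact Nat.zero_le _
  · exact Nat.zero_le _

theorem degree_mapDomain {α β : Type*} (f : α → β) (u : α →₀ ℕ) :
    (u.mapDomain f).degree = u.degree := by
  rw [Finsupp.mapDomain, Finsupp.sum, map_sum, Finsupp.degree_apply]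
  simp

/-- Up to a constant, the coefficient of `y^β` is `∏ (1 - p t)^{-β_p}`, where `β_p` is the degree of
`y^β` at `p`. For `β` in `box`, the common denominator clears it and leaves a polynomial in `t` of
degree at most `relBound ν - |ν| < s`. -/
theorem coeff_twist_mul_commonDen_mem (ν : ℕ →₀ ℕ) (s : ℕ)
    (hs : D.chain.relBound ν < s + ν.degree) :
    (D.twist (D.linFormMon ν) * (((D.commonDen ν).map MvPolynomial.C :
      Polynomial (MvPolynomial (ℕ × Fin D.N) ℂ)) :
        PowerSeries (MvPolynomial (ℕ × Fin D.N) ℂ))).coeff s ∈ D.boxIdeal := by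
  rw [(D.linFormMon ν).as_sum, map_sum, Finset.sum_mul, map_sum]
  refine Ideal.sum_mem _ fun β hβ => ?_
  rw [twist_monomial, mul_assoc, PowerSeries.coeff_C_mul]
  by_cases hbox : β ∈ D.box
  · have hν := D.mapDomain_fst_of_mem_support_linFormMon hβ
    have hle : ∀ p, β.mapDomain Prod.snd p ≤ min (partialSum ν (D.nn p)) (D.kk p) := fun p =>
      le_min (hν ▸ D.mapDomain_snd_le_partialSum hbox p) (hbox.2 p)
    have hprod : ((β.mapDomain Prod.snd).prod fun p e => D.geom p ^ e) *
        (((D.commonDen ν).map MvPolynomial.C : Polynomial (MvPolynomial (ℕ × Fin D.N) ℂ)) :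
          PowerSeries (MvPolynomial (ℕ × Fin D.N) ℂ)) =
        (((∏ p, D.den p ^ (min (partialSum ν (D.nn p)) (D.kk p) - β.mapDomain Prod.snd p)).map
          MvPolynomial.C : Polynomial (MvPolynomial (ℕ × Fin D.N) ℂ)) :
          PowerSeries (MvPolynomial (ℕ × Fin D.N) ℂ)) := by
      rw [Finsupp.prod_fintype _ _ (by simp), commonDen, Polynomial.map_prod, Polynomial.map_prod,
        ← Polynomial.coeToPowerSeries.ringHom_apply, ← Polynomial.coeToPowerSeries.ringHom_apply,
        map_prod, map_prod, ← Finset.prod_mul_distrib]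
      refine Finset.prod_congr rfl fun p _ => ?_
      rw [Polynomial.map_pow, Polynomial.map_pow, map_pow, map_pow]
      conv_lhs => rw [← Nat.add_sub_cancel' (hle p), pow_add, ← mul_assoc, ← mul_pow]
      rw [Polynomial.coeToPowerSeries.ringHom_apply, geom_mul_den, one_pow, one_mul]
    rw [hprod, Polynomial.coeff_coe, Polynomial.coeff_map, Polynomial.coeff_eq_zero_of_natDegree_lt,
      map_zero, mul_zero]
    · exact zero_mem _
    · have h1 := natDegree_prod_pow_le Finset.univ D.den
        (fun p => min (partialSum ν (D.nn p)) (D.kk p) - β.mapDomain Prod.snd p) (fun _ => 1)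
        fun p _ => D.natDegree_den_le p
      simp only [mul_one] at h1
      have h2 : ∑ p, (min (partialSum ν (D.nn p)) (D.kk p) - β.mapDomain Prod.snd p) + ν.degree =
          D.chain.relBound ν := by
        rw [relBound_chain, ← hν, degree_mapDomain, ← degree_mapDomain Prod.snd,
          Finsupp.degree_eq_sum, hν, ← Finset.sum_add_distrib]
        exact Finset.sum_congr rfl fun p _ => Nat.sub_add_cancel (hle p)
      omega
  · refine Ideal.mul_mem_right _ _ (D.mem_boxIdeal_iff.2 fun γ hγ => ?_)
    rw [MvPolynomial.coeff_monomial, if_neg]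
    rintro rfl
    exact hbox hγ

/-- The common denominator has constant term `1`, so multiplying by it changes the coefficient of
`t^s` only by scalar multiples of earlier coefficients, which have lower weight. -/
theorem exists_deformation (ν : ℕ →₀ ℕ) (s : ℕ) (hs : D.chain.relBound ν < s + ν.degree) :
    ∃ g ∈ D.boxIdeal.comap D.pointHom, (seriesMon ν).coeff s - g ∈ lowWeight s := by
  set Δ : PowerSeries SymbolRing :=
    (((D.commonDen ν).map MvPolynomial.C : Polynomial SymbolRing) : PowerSeries SymbolRing)
    with hΔ
  refine ⟨(seriesMon ν * Δ).coeff s, ?_, ?_⟩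
  · rw [Ideal.mem_comap]
    have h := D.coeff_twist_mul_commonDen_mem ν s hs
    have h1 : PowerSeries.map (D.pointHom : SymbolRing →+* MvPolynomial (ℕ × Fin D.N) ℂ) Δ =
        (((D.commonDen ν).map MvPolynomial.C : Polynomial (MvPolynomial (ℕ × Fin D.N) ℂ)) :
          PowerSeries (MvPolynomial (ℕ × Fin D.N) ℂ)) := by
      ext1 i
      simp [hΔ]
    rw [← map_pointHom_seriesMon, ← h1, ← map_mul, PowerSeries.coeff_map] at h
    exact h
  · have h0 : Δ.coeff 0 = 1 := by
      simp [hΔ, commonDen, den, Polynomial.coeff_zero_eq_eval_zero, Polynomial.eval_prod]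
    have hC : ∀ j, ∃ c : ℂ, (1 - Δ).coeff j = MvPolynomial.C c := by
      intro j
      refine ⟨(1 : PowerSeries ℂ).coeff j - (D.commonDen ν).coeff j, ?_⟩
      rw [map_sub, map_sub, hΔ, Polynomial.coeff_coe, Polynomial.coeff_map,
        PowerSeries.coeff_one, PowerSeries.coeff_one]
      split_ifs <;> simp
    rw [← map_sub, ← mul_one_sub, PowerSeries.coeff_mul]
    refine Submodule.sum_mem _ fun v hv => ?_
    have hv := Finset.HasAntidiagonal.mem_antidiagonal.1 hv
    rcases Nat.eq_zero_or_pos v.2 with h | h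
    · have : (1 - Δ).coeff 0 = 0 := by
        rw [map_sub, h0]
        simp
      rw [h, this, mul_zero]
      exact zero_mem _
    · obtain ⟨c, hc⟩ := hC v.2
      rw [hc, mul_comm, ← MvPolynomial.smul_eq_C_mul]
      exact Submodule.smul_mem _ _ (mem_lowWeight_of_isWeightedHomogeneous (by omega)
        (isWeightedHomogeneous_coeff_seriesMon ν v.1))

/-- The points are distinct, so Lagrange interpolation isolates each `y_{a,p}` in the image. -/
theorem exists_pointHom_eq_monomial {β : ℕ × Fin D.N →₀ ℕ} (hβ : β ∈ D.box) :
    ∃ f, D.pointHom f = MvPolynomial.monomial β 1 := by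
  have hX : ∀ v ∈ β.support, MvPolynomial.X v ∈ D.pointHom.range := by
    rintro ⟨a, p⟩ hv
    have ha := hβ.1 _ hv
    set q : Polynomial ℂ := Lagrange.basis Finset.univ (fun p : Fin D.N => (p : ℂ)) p with hq
    have hinj : Set.InjOn (fun p : Fin D.N => (p : ℂ)) (Finset.univ : Finset (Fin D.N)) :=
      fun p _ p' _ h => Fin.ext (Nat.cast_injective h)
    have heval : ∀ p' : Fin D.N, ∑ i ∈ Finset.range (q.natDegree + 1),
        q.coeff i * (p' : ℂ) ^ i = if p' = p then 1 else 0 := by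
      intro p'
      rw [← Polynomial.eval_eq_sum_range]
      split_ifs with h
      · subst h
        exact Lagrange.eval_basis_self (v := fun p : Fin D.N => (p : ℂ)) hinj (Finset.mem_univ _)
      · exact Lagrange.eval_basis_of_ne (v := fun p : Fin D.N => (p : ℂ)) (Ne.symm h)
          (Finset.mem_univ _)
    refine ⟨∑ i ∈ Finset.range (q.natDegree + 1), MvPolynomial.C (q.coeff i) *
      MvPolynomial.X (a, i), ?_⟩
    rw [AlgHom.toRingHom_eq_coe, RingHom.coe_coe, map_sum]
    simp only [pointHom, map_mul, MvPolynomial.aeval_C, MvPolynomial.aeval_X,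
      MvPolynomial.algebraMap_eq, Finset.mul_sum]
    rw [Finset.sum_comm, Finset.sum_eq_single p]
    · simp only [ha, and_self, if_true, ← mul_assoc, ← map_mul]
      rw [← Finset.sum_mul, ← map_sum, heval, if_pos rfl, map_one, one_mul]
    · intro p' _ hp'
      split_ifs
      · simp only [← mul_assoc, ← map_mul]
        rw [← Finset.sum_mul, ← map_sum, heval, if_neg hp', map_zero, zero_mul]
      · simp
    · simp
  rw [MvPolynomial.monomial_eq, map_one, one_mul]
  exact (Subalgebra.prod_mem D.pointHom.range fun v hv =>
    Subalgebra.pow_mem _ (hX v hv) _ : _ ∈ D.pointHom.range)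

theorem card_le_ncard_of_span (S : Set Mon) (hfin : S.Finite)
    (hS : ∀ f, ∃ g ∈ monSpan S, ∃ h ∈ D.chain.relIdeal, f = g + h)
    (T : Finset (ℕ × Fin D.N →₀ ℕ)) (hT : ↑T ⊆ D.box) : T.card ≤ S.ncard := by
  have hspan := top_le_monSpan_sup_of_deformation D.chain (D.boxIdeal.comap D.pointHom)
    D.exists_deformation S hS
  let L : SymbolRing →ₗ[ℂ] (T → ℂ) :=
    LinearMap.pi fun β => (MvPolynomial.lcoeff ℂ (β : ℕ × Fin D.N →₀ ℕ)).comp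
      D.pointHom.toLinearMap
  have hL : ∀ f (β : T), L f β = (D.pointHom f).coeff β := fun f β => rfl
  have hsurj : LinearMap.range L = ⊤ := by
    rw [eq_top_iff, ← (Pi.basisFun ℂ T).span_eq]
    refine Submodule.span_le.2 ?_
    rintro _ ⟨β, rfl⟩
    obtain ⟨f, hf⟩ := D.exists_pointHom_eq_monomial (hT β.2)
    refine ⟨f, ?_⟩
    ext γ
    rw [hL, hf, MvPolynomial.coeff_monomial]
    rw [Pi.basisFun_apply, Pi.single_apply]
    simp only [Subtype.ext_iff, eq_comm]
  have hker : ∀ f ∈ D.boxIdeal.comap D.pointHom, L f = 0 := by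
    intro f hf
    ext β
    exact D.mem_boxIdeal_iff.1 hf β (hT β.2)
  have htop : Submodule.span ℂ (L '' ((fun m => MvPolynomial.monomial m 1) '' S)) = ⊤ := by
    rw [← Submodule.map_span, eq_top_iff, ← hsurj]
    rintro _ ⟨f, rfl⟩
    obtain ⟨g, hg, h, hh, rfl⟩ := Submodule.mem_sup.1 (hspan (Submodule.mem_top (x := f)))
    refine ⟨g, hg, ?_⟩
    rw [map_add, hker h hh, add_zero]
  have hfin' : (L '' ((fun m => MvPolynomial.monomial m 1) '' S)).Finite := (hfin.image _).image _
  have h1 := finrank_span_finset_le_card (R := ℂ) hfin'.toFinset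
  rw [Set.Finite.coe_toFinset, Set.finrank, htop, finrank_top, Module.finrank_fintype_fun_eq_card,
    Fintype.card_coe, ← Set.ncard_eq_toFinset_card _ hfin'] at h1
  exact h1.trans ((Set.ncard_image_le (hfin.image _)).trans (Set.ncard_image_le hfin))

end Datum

namespace Datum

/-! ### Linear independence -/

/-! ### Operations on `(n, k)` matching the recursion -/

section

variable {n : ℕ} (D : Datum (n + 1))

/-- The datum with all `n_p` lowered to at most `n`. -/
def lowerAll (hn : 1 ≤ n) : Datum n where
  pos := hn
  N := D.N
  nn p := min (D.nn p) n
  kk := D.kk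
  one_le p := le_min (D.one_le p) hn
  le _ := min_le_right _ _

/-- The datum with `n_p` replaced by `n` for `p = q`. -/
def lower (hn : 1 ≤ n) (q : Fin D.N) : Datum (n + 1) where
  pos := D.pos
  N := D.N
  nn := Function.update D.nn q n
  kk := D.kk
  one_le p := by
    by_cases h : p = q
    · subst h; simpa using hn
    · simpa [h] using D.one_le p
  le p := by
    by_cases h : p = q
    · subst h; simp
    · simpa [h] using D.le p

/-- The datum with `k_p` replaced by `k_p - 1` for `p = q`. -/
def decrease (q : Fin D.N) : Datum (n + 1) where
  pos := D.pos
  N := D.N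
  nn := D.nn
  kk := Function.update D.kk q (D.kk q - 1)
  one_le := D.one_le
  le := D.le

theorem lt_of_nn_eq {p : Fin D.N} (hp : D.nn p = n + 1) {j : ℕ} (hj : j < D.kk p) :
    j < D.chain.topLength := by
  rw [PartitionChain.lt_topLength_iff_diff, diff_chain]
  exact Finset.sum_pos' (fun _ _ => Nat.zero_le _) ⟨p, Finset.mem_univ p, by simp [hp, hj]⟩

/-- The length of a conjugate partition is the largest of the original parts. Such a `p` is where
both recursive moves are made. -/
theorem exists_kk_eq_topLength (h : 0 < D.chain.topLength) :
    ∃ p, D.nn p = n + 1 ∧ D.kk p = D.chain.topLength := by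
  have h1 := (D.chain.lt_topLength_iff_diff (D.chain.topLength - 1)).1 (by omega)
  rw [diff_chain] at h1
  obtain ⟨p, -, hp⟩ := Finset.exists_ne_zero_of_sum_ne_zero h1.ne'
  have hp : D.nn p = n + 1 ∧ D.chain.topLength - 1 < D.kk p := by
    by_contra hc
    exact hp (if_neg hc)
  refine ⟨p, hp.1, le_antisymm ?_ (by omega)⟩
  by_contra hc
  exact lt_irrefl _ (D.lt_of_nn_eq hp.1 (not_le.1 hc))

theorem chain_lowerAll (hn : 1 ≤ n) (h : D.chain.part (n + 1) = D.chain.part n) :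
    (D.lowerAll hn).chain = D.chain.trunc hn h := by
  have h0 := D.chain.topLength_eq_zero_of_part_eq h
  apply PartitionChain.ext
  funext a j
  change Finset.card (Finset.univ.filter fun p => min (D.nn p) n ≤ a ∧ j < D.kk p) =
    Finset.card (Finset.univ.filter fun p => D.nn p ≤ a ∧ j < D.kk p)
  congr 1
  ext p
  simp only [Finset.mem_filter, Finset.mem_univ, true_and]
  have h1 := D.le p
  by_cases hp : D.nn p = n + 1
  · have h2 : ¬j < D.kk p := fun h2 => by
      have := D.lt_of_nn_eq hp h2
      omega
    simp [h2]
  · rw [min_eq_left (by omega)]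

theorem chain_lower (hn : 1 ≤ n) {q : Fin D.N} (hq : D.nn q = n + 1)
    (hk : D.kk q = D.chain.topLength) : (D.lower hn q).chain = D.chain.addColumn hn := by
  apply PartitionChain.ext
  funext a j
  change Finset.card (Finset.univ.filter fun p => Function.update D.nn q n p ≤ a ∧ j < D.kk p) =
    if a = n ∧ j < D.chain.topLength
    then Finset.card (Finset.univ.filter fun p => D.nn p ≤ a ∧ j < D.kk p) + 1
    else Finset.card (Finset.univ.filter fun p => D.nn p ≤ a ∧ j < D.kk p)
  rw [Finset.card_filter, Finset.card_filter, ← Finset.add_sum_erase _ _ (Finset.mem_univ q),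
    ← Finset.add_sum_erase _ (fun p => if D.nn p ≤ a ∧ j < D.kk p then 1 else 0)
      (Finset.mem_univ q), Function.update_self, hk, hq,
    Finset.sum_congr rfl fun p hp => by rw [Function.update_of_ne (Finset.ne_of_mem_erase hp)]]
  split_ifs <;> omega

theorem chain_decrease {q : Fin D.N} (hq : D.nn q = n + 1)
    (hk : D.kk q = D.chain.topLength) : (D.decrease q).chain = D.chain.removeBox := by
  apply PartitionChain.ext
  funext a j
  change Finset.card (Finset.univ.filter fun p => D.nn p ≤ a ∧
      j < Function.update D.kk q (D.kk q - 1) p) =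
    if n + 1 ≤ a ∧ j + 1 = D.chain.topLength
    then Finset.card (Finset.univ.filter fun p => D.nn p ≤ a ∧ j < D.kk p) - 1
    else Finset.card (Finset.univ.filter fun p => D.nn p ≤ a ∧ j < D.kk p)
  rw [Finset.card_filter, Finset.card_filter, ← Finset.add_sum_erase _ _ (Finset.mem_univ q),
    ← Finset.add_sum_erase _ (fun p => if D.nn p ≤ a ∧ j < D.kk p then 1 else 0)
      (Finset.mem_univ q), Function.update_self, hk, hq,
    Finset.sum_congr rfl fun p hp => by rw [Function.update_of_ne (Finset.ne_of_mem_erase hp)]]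
  split_ifs <;> omega

theorem box_lowerAll_subset (hn : 1 ≤ n) : (D.lowerAll hn).box ⊆ D.box := fun _ hβ =>
  ⟨fun v hv => ⟨(hβ.1 v hv).1, (hβ.1 v hv).2.trans_le (min_le_left _ _)⟩, hβ.2⟩

theorem lt_of_mem_box_lower {hn : 1 ≤ n} {q : Fin D.N} {β : ℕ × Fin D.N →₀ ℕ}
    (hβ : β ∈ (D.lower hn q).box) {v : ℕ × Fin D.N} (hv : v ∈ β.support) :
    1 ≤ v.1 ∧ v.1 < Function.update D.nn q n v.2 :=
  hβ.1 v hv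

theorem box_lower_subset (hn : 1 ≤ n) {q : Fin D.N} (hq : D.nn q = n + 1) :
    (D.lower hn q).box ⊆ D.box := fun β hβ => by
  refine ⟨fun v hv => ?_, hβ.2⟩
  have h := D.lt_of_mem_box_lower hβ hv
  refine ⟨h.1, ?_⟩
  by_cases hvq : v.2 = q
  · rw [hvq, Function.update_self] at h
    rw [hvq, hq]
    omega
  · rw [Function.update_of_ne hvq] at h
    exact h.2

theorem eq_zero_of_mem_box_lower {hn : 1 ≤ n} {q : Fin D.N} {β : ℕ × Fin D.N →₀ ℕ}
    (hβ : β ∈ (D.lower hn q).box) : β (n, q) = 0 := by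
  by_contra h
  have := D.lt_of_mem_box_lower hβ (Finsupp.mem_support_iff.2 h)
  simp at this

theorem add_single_mem_box (hn : 1 ≤ n) {q : Fin D.N} (hq : D.nn q = n + 1) (hk : 0 < D.kk q)
    {β : ℕ × Fin D.N →₀ ℕ} (hβ : β ∈ (D.decrease q).box) :
    β + Finsupp.single (n, q) 1 ∈ D.box := by
  have hβ1 : ∀ v ∈ β.support, 1 ≤ v.1 ∧ v.1 < D.nn v.2 := hβ.1
  have hβ2 : ∀ p, β.mapDomain Prod.snd p ≤ Function.update D.kk q (D.kk q - 1) p := hβ.2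
  refine ⟨fun v hv => ?_, fun p => ?_⟩
  · by_cases h : v = (n, q)
    · subst h
      simp [hn, hq]
    · refine hβ1 v (Finsupp.mem_support_iff.2 fun h0 => Finsupp.mem_support_iff.1 hv ?_)
      rw [Finsupp.add_apply, h0, Finsupp.single_eq_of_ne h, add_zero]
  · have := hβ2 p
    rw [Finsupp.mapDomain_add, Finsupp.mapDomain_single, Finsupp.add_apply]
    by_cases h : p = q
    · subst h
      rw [Function.update_self] at this
      rw [Finsupp.single_eq_same]
      omega
    · rw [Function.update_of_ne h] at this
      rwa [Finsupp.single_eq_of_ne h, add_zero]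

end

/-- The exponents from `lower` vanish at `(n, q)`, while those from `decrease` are translated to be
positive there, so the two pieces are disjoint and the counts add up. -/
theorem exists_finset_subset_box (n : ℕ) (μ : PartitionChain n) (D : Datum n) (hD : D.chain = μ) :
    ∃ T : Finset (ℕ × Fin D.N →₀ ℕ), ↑T ⊆ D.box ∧ (basisMonomials n μ).ncard ≤ T.card := by
  classical
  induction n, μ using PartitionChain.recursionInduction with
  | base μ =>
    refine ⟨{0}, ?_, ?_⟩
    · rw [Finset.coe_singleton, Set.singleton_subset_iff]
      exact ⟨by simp, by simp⟩
    · rw [isRecursiveFamily_basisMonomials.base, Set.ncard_singleton, Finset.card_singleton]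
  | trunc n hn μ h ih =>
    subst hD
    obtain ⟨T, hT, hcard⟩ := ih (D.lowerAll hn) (D.chain_lowerAll hn h)
    rw [isRecursiveFamily_basisMonomials.trunc n hn _ h]
    exact ⟨T, hT.trans (D.box_lowerAll_subset hn), hcard⟩
  | step n hn μ h ih₁ ih₂ =>
    subst hD
    obtain ⟨q, hq, hk⟩ := D.exists_kk_eq_topLength h
    obtain ⟨T₁, hT₁, hcard₁⟩ := ih₁ (D.lower hn q) (D.chain_lower hn hq hk)
    obtain ⟨T₂, hT₂, hcard₂⟩ := ih₂ (D.decrease q) (D.chain_decrease hq hk)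
    change Finset (ℕ × Fin D.N →₀ ℕ) at T₁ T₂
    refine ⟨T₁ ∪ T₂.image (· + Finsupp.single (n, q) 1), ?_, ?_⟩
    · rw [Finset.coe_union, Finset.coe_image, Set.union_subset_iff, Set.image_subset_iff]
      exact ⟨hT₁.trans (D.box_lower_subset hn hq),
        fun β hβ => D.add_single_mem_box hn hq (by omega) (hT₂ hβ)⟩
    · rw [Finset.card_union_of_disjoint, Finset.card_image_of_injective _ (add_left_injective _),
        isRecursiveFamily_basisMonomials.step n hn _ h]
      · refine (Set.ncard_union_le _ _).trans (add_le_add ?_ ?_)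
        · exact (Set.ncard_image_le (finite_basisMonomials _ _)).trans hcard₁
        · exact (Set.ncard_image_le (finite_basisMonomials _ _)).trans hcard₂
      · rw [Finset.disjoint_left]
        intro β hβ hβ'
        obtain ⟨γ, -, rfl⟩ := Finset.mem_image.1 hβ'
        have := D.eq_zero_of_mem_box_lower (hT₁ hβ)
        simp at this

/-! ### The basis of `W(n, k)` and the induced maps -/

variable {n : ℕ} (D : Datum n)

theorem map_toW_monSpan (S : Set Mon) :
    (monSpan S).map D.toW.toLinearMap = Submodule.span ℂ (D.mon '' S) := by
  rw [monSpan, Submodule.map_span, Set.image_image]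
  congr 2
  funext m
  exact D.toW_monomial m

/-- A dependent monomial could be dropped from the spanning set, leaving fewer than `|B| ≤ |T|`
monomials, against the count in the tensor product. -/
theorem linearIndependent_mon :
    LinearIndependent ℂ fun m : basisMonomials n D.chain => D.mon m := by
  rw [linearIndependent_iff_notMem_span]
  rintro ⟨m, hm⟩ hmem
  set S := basisMonomials n D.chain \ {m} with hS
  have himg : (fun m : basisMonomials n D.chain => D.mon m) '' (Set.univ \ {⟨m, hm⟩}) =
      D.mon '' S := by
    ext w
    constructor
    · rintro ⟨⟨m', hm'⟩, h, rfl⟩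
      exact ⟨m', ⟨hm', fun h' => h.2 (Subtype.ext h')⟩, rfl⟩
    · rintro ⟨m', ⟨hm', h⟩, rfl⟩
      exact ⟨⟨m', hm'⟩, ⟨Set.mem_univ _, fun h' => h (congrArg Subtype.val h')⟩, rfl⟩
  rw [himg, ← map_toW_monSpan] at hmem
  obtain ⟨g, hg, hgm⟩ := hmem
  have hgm : D.toW g = D.mon m := hgm
  have hker : MvPolynomial.monomial m 1 - g ∈ D.chain.relIdeal := by
    rw [← D.toW_eq_zero_iff, map_sub, D.toW_monomial, hgm, sub_self]
  have hle : monSpan (basisMonomials n D.chain) ≤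
      monSpan S ⊔ D.chain.relIdeal.restrictScalars ℂ := by
    refine Submodule.span_le.2 ?_
    rintro _ ⟨m', hm', rfl⟩
    by_cases h : m' = m
    · subst h
      exact Submodule.mem_sup.2 ⟨g, hg, _, hker, add_sub_cancel _ _⟩
    · exact (le_sup_left : monSpan S ≤ _) (Submodule.subset_span ⟨m', ⟨hm', h⟩, rfl⟩)
  have hspan : ∀ f, ∃ g ∈ monSpan S, ∃ h ∈ D.chain.relIdeal, f = g + h := by
    intro f
    obtain ⟨g, hg, h, hh, rfl⟩ := exists_monSpan_add_relIdeal n D.chain f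
    obtain ⟨g', hg', h', hh', rfl⟩ := Submodule.mem_sup.1 (hle hg)
    exact ⟨g', hg', h' + h, add_mem hh' hh, add_assoc _ _ _⟩
  obtain ⟨T, hT, hcard⟩ := exists_finset_subset_box n D.chain D rfl
  have h1 := D.card_le_ncard_of_span S ((finite_basisMonomials n D.chain).sdiff) hspan T hT
  have h2 : S.ncard < _ := Set.ncard_sdiff_singleton_lt_of_mem hm (finite_basisMonomials n D.chain)
  omega

theorem top_le_span_mon :
    ⊤ ≤ Submodule.span ℂ (Set.range fun m : basisMonomials n D.chain => D.mon m) := by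
  intro w _
  obtain ⟨f, rfl⟩ := D.toW_surjective w
  obtain ⟨g, hg, h, hh, rfl⟩ := exists_monSpan_add_relIdeal n D.chain f
  rw [map_add, D.toW_eq_zero_iff.2 hh, add_zero]
  have h1 : D.toW g ∈ (monSpan (basisMonomials n D.chain)).map D.toW.toLinearMap := ⟨g, hg, rfl⟩
  rw [map_toW_monSpan, Set.image_eq_range] at h1
  exact h1

/-- A symbol outside the index set would make the class of the monomial zero, contradicting
independence. -/
theorem mem_vars_of_mem_basisMonomials {m : Mon} (hm : m ∈ basisMonomials n D.chain)
    {v : ℕ × ℕ} (hv : v ∈ m.support) : v ∈ D.vars := by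
  by_contra h
  refine D.linearIndependent_mon.ne_zero ⟨m, hm⟩ ?_
  have h1 : m = Finsupp.single v 1 + (m - Finsupp.single v 1) := by
    rw [add_tsub_cancel_of_le]
    rw [Finsupp.single_le_iff]
    exact Nat.one_le_iff_ne_zero.2 (Finsupp.mem_support_iff.1 hv)
  change D.mon m = 0
  rw [← D.toW_monomial, D.toW_eq_zero_iff, h1, MvPolynomial.monomial_single_add, pow_one]
  exact Ideal.mul_mem_right _ _ (D.X_mem_relIdeal_of_notMem_vars h)

theorem mon_injOn : Set.InjOn D.mon (basisMonomials n D.chain) :=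
  Set.injOn_iff_injective.2 D.linearIndependent_mon.injective

/-- The algebra homomorphism `W(n', k') → W(n, k)` induced by an endomorphism of the ring of
symbols which is compatible with the relations. -/
theorem exists_algHom_of_relIdeal_le {n' : ℕ} (D' : Datum n') (φ : SymbolRing →ₐ[ℂ] SymbolRing)
    (h : D'.chain.relIdeal ≤ D.chain.relIdeal.comap φ) :
    ∃ ι : D'.W →ₐ[ℂ] D.W, ∀ f, ι (D'.toW f) = D.toW (φ f) := by
  let e := Ideal.quotientKerAlgEquivOfSurjective D'.toW_surjective
  let ψ := Ideal.Quotient.liftₐ (RingHom.ker D'.toW) (D.toW.comp φ) fun f hf =>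
    D.toW_eq_zero_iff.2 (h (D'.toW_eq_zero_iff.1 hf))
  refine ⟨ψ.comp (e.symm : D'.W →ₐ[ℂ] _), fun f => ?_⟩
  have he : e.symm (D'.toW f) = Ideal.Quotient.mk _ f := by
    rw [AlgEquiv.symm_apply_eq]
    rfl
  change ψ (e.symm (D'.toW f)) = _
  rw [he]
  rfl

theorem mon_mulX0 (a : ℕ) (m : Mon) : D.mon (mulX0 a m) = D.gen a 0 * D.mon m := by
  rw [← toW_monomial, ← toW_monomial, ← toW_X, ← map_mul, mulX0,
    MvPolynomial.monomial_single_add, pow_one]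

end Datum

end FusionBasis

end

/-! ### The theorem -/

open FusionBasis in
theorem theorem2p12 :
    ∃ B : (n : ℕ) → PartitionChain n → Set Mon,
      IsRecursiveFamily B ∧
      (∀ B' : (n : ℕ) → PartitionChain n → Set Mon, IsRecursiveFamily B' → B' = B) ∧
      -- the monomials in `B` lie in the ring `R`, and their classes form a basis of `W`
      (∀ (n : ℕ) (μ : PartitionChain n) (D : Datum n), D.chain = μ →
        (∀ m ∈ B n μ, ∀ v ∈ m.support, v ∈ D.vars) ∧
        ∃ b : Module.Basis (B n μ) ℂ D.W, ∀ m : B n μ, b m = D.mon m) ∧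
      -- the recursion for the bases, as subsets of the modules `W`
      (∀ (n : ℕ) (hn : 1 ≤ n) (μ : PartitionChain (n + 1)), 0 < μ.topLength →
        ∀ D D' : Datum (n + 1), D.chain = μ → D'.chain = μ.addColumn hn →
          ∃ ι : D'.W →ₐ[ℂ] D.W,
            (∀ b i : ℕ, ι (D'.gen b i) = D.gen b (i + if b = n then 1 else 0)) ∧
            D.mon '' B (n + 1) μ =
              ι '' (D'.mon '' B (n + 1) (μ.addColumn hn)) ∪
                (fun m => D.gen n 0 * D.mon m) '' B (n + 1) μ.removeBox ∧
            Disjoint (ι '' (D'.mon '' B (n + 1) (μ.addColumn hn)))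
              ((fun m => D.gen n 0 * D.mon m) '' B (n + 1) μ.removeBox)) := by
  refine ⟨basisMonomials, isRecursiveFamily_basisMonomials,
    fun B' hB' => hB'.eq isRecursiveFamily_basisMonomials, ?_, ?_⟩
  · rintro n _ D rfl
    exact ⟨fun m hm v hv => D.mem_vars_of_mem_basisMonomials hm hv,
      Module.Basis.mk D.linearIndependent_mon D.top_le_span_mon,
      fun m => Module.Basis.mk_apply _ _ m⟩
  · rintro n hn _ hpos D D' rfl hD'
    obtain ⟨ι, hι⟩ := D.exists_algHom_of_relIdeal_le D' (shiftHom n)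
      (hD' ▸ D.chain.relIdeal_addColumn_le_comap_shiftHom hn)
    have h1 : ι '' (D'.mon '' basisMonomials (n + 1) (D.chain.addColumn hn)) =
        D.mon '' (shift n '' basisMonomials (n + 1) (D.chain.addColumn hn)) := by
      rw [Set.image_image, Set.image_image]
      refine Set.image_congr fun m _ => ?_
      rw [← D'.toW_monomial, hι, shiftHom_monomial, D.toW_monomial]
    have h2 : (fun m => D.gen n 0 * D.mon m) '' basisMonomials (n + 1) D.chain.removeBox =
        D.mon '' (mulX0 n '' basisMonomials (n + 1) D.chain.removeBox) := by
      rw [Set.image_image]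
      exact Set.image_congr fun m _ => (D.mon_mulX0 n m).symm
    have h3 := isRecursiveFamily_basisMonomials.step n hn D.chain hpos
    refine ⟨ι, fun b i => ?_, ?_, ?_⟩
    · rw [← D'.toW_X, hι, shiftHom_X, D.toW_X]
    · rw [h1, h2, h3, Set.image_union]
    · rw [h1, h2]
      -- Distinct monomials of `B` have distinct classes, so disjointness passes from monomials to
      -- classes.
      refine Set.disjoint_image_image fun m hm m' hm' h => ?_
      have := D.mon_injOn (h3 ▸ Or.inl hm) (h3 ▸ Or.inr hm') h
      subst this
      exact Set.disjoint_left.1 (disjoint_shift_mulX0 n _ _) hm hm'
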